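/- Let $\mathbf k$ be $\mathbb R$ or $\mathbb C$ and $V$ a finite-dimensional vector space over $\mathbf k$. *Conventions.* Let $W$ be a module over a commutative ring $A$ and $I\subset W\otimes_A W$ a submodule. For $k\ge 2$ let $I^k$ (resp. $I^{(k)}$) be the sum (resp. the intersection) of the $k-1$ submodules $W\otimes\cdots\otimes I\otimes\cdots\otimes W$ of $W^{\otimes k}$, with $I$ in positions $i,i+1$. A pair $(I,J)$ of submodules of $W^{\otimes 2}$ is *well situated* if $W^{\otimes k}=I^{(k)}\oplus J^k$ for all $k\ge 2$. The *quadratic algebra* $(W,J)$ is the graded algebra $T(W)/\langle J\rangle$, where $\langle J\rangle$ is the two-sided ideal generated by $J$. For an operator $S$ on $W^{\otimes 2}$, let $S_i$ be the operator on $W^{\otimes k}$ equal to $S$ in positions $i,i+1$ and to the identity elsewhere, and let $A_k(S)\subset \mathrm{End}(W^{\otimes k})$ be the unital subalgebra generated by $S_1,\dots,S_{k-1}$. For $W$ free of finite rank and submodules $I_1,\dots,I_n\subset W^{\otimes 2}$, the *quantum semigroup* $M(W;I_1,\dots,I_n)$ is the quadratic algebra $(\mathrm{End}(W),I)$ with $I=\sigma_{2,3}(I_1\otimes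 I_1^\perp+\cdots+I_n\otimes I_n^\perp)$, where $\mathrm{End}(W)=W\otimes W^*$, $I_i^\perp\subset (W^{*})^{\otimes 2}$ is the annihilator of $I_i$, and $\sigma_{2,3}$ permutes the second and third tensor factors. Write $E[[h]]=\mathbf k[[h]]\otimes_{\mathbf k}E$ for a finite-dimensional space $E$; tensor powers of $V[[h]]$ are taken over $\mathbf k[[h]]$, so $V[[h]]^{\otimes k}=V^{\otimes k}[[h]]$, and $\mathrm{End}(V[[h]])=\mathrm{End}(V)[[h]]$. A submodule is *splitting* if it has a complementary submodule. A *deformation* of a subspace $J\subset E$ is a splitting submodule $J_h\subset E[[h]]$ whose image under $h\mapsto 0$ is $J$; a deformation of an operator $S$ on $E$ is a $\mathbf k[[h]]$-linear operator $S_h$ on $E[[h]]$ that reduces to $S$ at $h=0$. The quadratic algebra $(E[[h]],J_h)$ is a *flat deformation* of $(E,J)$ if $J_h$ is a deformation of $J\subset E^{\otimes 2}$ and all homogeneous components of $(E[[h]],J_h)$ are free $\mathbf k[[h]]$-modules. **Proposition.** Let $S$ be a linear operator on $V^{\otimes 2}$ all of whose eigenvalues lie in $\mathbf k$ (that is, its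 characteristic polynomial splits over $\mathbf k$; this is automatic for $\mathbf k=\mathbb C$). Let $\lambda_1,\dots,\lambda_n$ be its distinct eigenvalues, $I_1,\dots,I_n$ the corresponding eigenspaces, and $J_m=\bigoplus_{i\ne m}I_i$. Let $S_h$ be a deformation of $S$. Suppose that for all $k\ge 2$ the algebra $A_k(S)$ is semisimple and $A_k(S_h)$ is a splitting submodule of $\mathrm{End}(V[[h]]^{\otimes k})$. Then the eigenvalues and eigenspaces deform uniquely. That is, for each $i$ there is a unique eigenvalue $\lambda_{ih}\in\mathbf k[[h]]$ of $S_h$ with constant term $\lambda_i$; the eigensubmodule $I_{ih}=\mathrm{Ker}(S_h-\lambda_{ih})$ is a deformation of $I_i$, and it is the only deformation of $I_i$ on which $S_h$ acts by a scalar with constant term $\lambda_i$; and $V[[h]]^{\otimes 2}=\bigoplus_i I_{ih}$. Put $J_{mh}=\bigoplus_{i\neq m}I_{ih}$. Then: a) the pair $(I_{mh},J_{mh})$ is well situated for every $m=1,\dots,n$; b) the quadratic algebra $(V[[h]],J_{mh})$ is a flat deformation of $(V,J_m)$ for every $m$; c) the quantum semigroup $M(V[[h]];I_{1h},\dots,I_{nh})$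 is a flat deformation of $M(V;I_1,\dots,I_n)$. -/

import Mathlib

open scoped TensorProduct PowerSeries

noncomputable section

namespace QuadDef

section Generalities

variable (A : Type*) [CommRing A] (V : Type*) [AddCommGroup V] [Module A V]

/-- The identification of `V ⊗ V` with the second tensor power, `v ⊗ w ↦ ⨂ₜ ![v, w]`. -/
def twoEquiv : V ⊗[A] V ≃ₗ[A] ⨂[A]^2 V :=
  (TensorProduct.congr (PiTensorProduct.subsingletonEquiv (0 : Fin 1)).symm
    (PiTensorProduct.subsingletonEquiv (0 : Fin 1)).symm).trans
    (TensorPower.mulEquiv (n := 1) (m := 1))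

/-- The identification `V^{⊗a} ⊗ (V ⊗ V) ⊗ V^{⊗b} = V^{⊗k}`, for `a + 2 + b = k`. -/
def placeEquiv {a b k : ℕ} (h : a + 2 + b = k) :
    (⨂[A]^a V ⊗[A] (V ⊗[A] V)) ⊗[A] ⨂[A]^b V ≃ₗ[A] ⨂[A]^k V :=
  ((TensorProduct.congr
      ((TensorProduct.congr (LinearEquiv.refl A (⨂[A]^a V)) (twoEquiv A V)).trans
        TensorPower.mulEquiv)
      (LinearEquiv.refl A (⨂[A]^b V))).trans TensorPower.mulEquiv).trans
    (TensorPower.cast A V h)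

variable {A V}

/-- The operator on `V^{⊗k}` which is `S` in the positions `a + 1, a + 2` and the identity in the
other positions (there are `a` positions before and `b` positions after). -/
def opAt {a b k : ℕ} (h : a + 2 + b = k) (S : Module.End A (V ⊗[A] V)) :
    Module.End A (⨂[A]^k V) :=
  (placeEquiv A V h).toLinearMap ∘ₗ
    TensorProduct.map (TensorProduct.map LinearMap.id S) LinearMap.id ∘ₗ
    (placeEquiv A V h).symm.toLinearMap

/-- The submodule `V ⊗ ⋯ ⊗ I ⊗ ⋯ ⊗ V` of `V^{⊗k}`, with `I` in the positions `a + 1, a + 2`. -/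
def subAt {a b k : ℕ} (h : a + 2 + b = k) (I : Submodule A (V ⊗[A] V)) :
    Submodule A (⨂[A]^k V) :=
  LinearMap.range ((placeEquiv A V h).toLinearMap ∘ₗ
    TensorProduct.map (TensorProduct.map (LinearMap.id : ⨂[A]^a V →ₗ[A] ⨂[A]^a V) I.subtype)
      (LinearMap.id : ⨂[A]^b V →ₗ[A] ⨂[A]^b V))

/-- `I^k`: the sum of the submodules `V ⊗ ⋯ ⊗ I ⊗ ⋯ ⊗ V` of `V^{⊗k}` over all positions. -/
def sumSub (k : ℕ) (I : Submodule A (V ⊗[A] V)) : Submodule A (⨂[A]^k V) :=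
  ⨆ (a : ℕ) (b : ℕ) (h : a + 2 + b = k), subAt h I

/-- `I^{(k)}`: the intersection of the submodules `V ⊗ ⋯ ⊗ I ⊗ ⋯ ⊗ V` of `V^{⊗k}` over all
positions. -/
def interSub (k : ℕ) (I : Submodule A (V ⊗[A] V)) : Submodule A (⨂[A]^k V) :=
  ⨅ (a : ℕ) (b : ℕ) (h : a + 2 + b = k), subAt h I

/-- The pair `(I, J)` is well situated if `V^{⊗k} = I^{(k)} ⊕ J^k` for all `k ≥ 2`. -/
def IsWellSituated (I J : Submodule A (V ⊗[A] V)) : Prop :=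
  ∀ k : ℕ, 2 ≤ k → IsCompl (interSub k I) (sumSub k J)

/-- `A_k(S)`: the (unital) subalgebra of `End(V^{⊗k})` generated by the operators
`S_1, …, S_{k-1}`. -/
def genAlg (k : ℕ) (S : Module.End A (V ⊗[A] V)) : Subalgebra A (Module.End A (⨂[A]^k V)) :=
  Algebra.adjoin A {T | ∃ (a b : ℕ) (h : a + 2 + b = k), T = opAt h S}

/-- A submodule is splitting if it has a complementary submodule. -/
def IsSplitting {E : Type*} [AddCommGroup E] [Module A E] (J : Submodule A E) : Prop :=
  ∃ I : Submodule A E, IsCompl J I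

variable (A V) in
/-- The map `V ⊗ V → T(V)`, `v ⊗ w ↦ v w`. -/
def toTensorAlg : V ⊗[A] V →ₗ[A] TensorAlgebra A V :=
  TensorProduct.lift
    ((LinearMap.mul A (TensorAlgebra A V)).compl₁₂ (TensorAlgebra.ι A) (TensorAlgebra.ι A))

/-- The two-sided ideal of `T(V)` generated by `J ⊆ V ⊗ V`. -/
def quadIdeal (J : Submodule A (V ⊗[A] V)) : TwoSidedIdeal (TensorAlgebra A V) :=
  TwoSidedIdeal.span (toTensorAlg A V '' (J : Set (V ⊗[A] V)))

/-- The quadratic algebra `(V, J)`, i.e. the quotient of `T(V)` by the two-sided ideal generated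
by `J`. -/
abbrev QuadAlgebra (J : Submodule A (V ⊗[A] V)) : Type _ :=
  (quadIdeal J).ringCon.Quotient

/-- The `k`-th homogeneous component of the quadratic algebra `(V, J)`: the image of the `k`-th
homogeneous component of `T(V)`. -/
def quadComponent (J : Submodule A (V ⊗[A] V)) (k : ℕ) : Submodule A (QuadAlgebra J) :=
  ((LinearMap.range (TensorAlgebra.ι A : V →ₗ[A] TensorAlgebra A V)) ^ k).map
    ((quadIdeal J).ringCon.mkₐ A).toLinearMap

/-- `I^⊥ ⊆ V^* ⊗ V^*`: the tensors which, as functionals on `V ⊗ V`, vanish on `I`. -/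
def perp (I : Submodule A (V ⊗[A] V)) :
    Submodule A (Module.Dual A V ⊗[A] Module.Dual A V) :=
  I.dualAnnihilator.comap (TensorProduct.dualDistrib A V V)

variable (A V) in
/-- The canonical map `V ⊗ V^* → End(V)`, `v ⊗ φ ↦ (x ↦ φ(x) v)`. -/
def toEnd : V ⊗[A] Module.Dual A V →ₗ[A] Module.End A V :=
  dualTensorHom A V V ∘ₗ (TensorProduct.comm A V (Module.Dual A V)).toLinearMap

variable (A V) in
/-- The map `σ_{2,3} : V ⊗ V ⊗ V^* ⊗ V^* → (V ⊗ V^*) ⊗ (V ⊗ V^*) = End(V) ⊗ End(V)`. -/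
def sigma23 : (V ⊗[A] V) ⊗[A] (Module.Dual A V ⊗[A] Module.Dual A V) →ₗ[A]
    Module.End A V ⊗[A] Module.End A V :=
  TensorProduct.map (toEnd A V) (toEnd A V) ∘ₗ
    (TensorProduct.tensorTensorTensorComm A V V (Module.Dual A V) (Module.Dual A V)).toLinearMap

/-- The relations `σ_{2,3}(I_1 ⊗ I_1^⊥ + ⋯ + I_n ⊗ I_n^⊥) ⊆ End(V) ⊗ End(V)`. The quantum
semigroup `M(V; I_1, …, I_n)` is the quadratic algebra `(End(V), semigroupRel I)`. -/
def semigroupRel {n : ℕ} (I : Fin n → Submodule A (V ⊗[A] V)) :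
    Submodule A (Module.End A V ⊗[A] Module.End A V) :=
  (⨆ i, LinearMap.range (TensorProduct.map (I i).subtype (perp (I i)).subtype)).map (sigma23 A V)

end Generalities

section Deformations

variable {𝕜 : Type*} [Field 𝕜]

instance constantCoeffSurjective :
    RingHomSurjective (PowerSeries.constantCoeff : 𝕜⟦X⟧ →+* 𝕜) :=
  ⟨PowerSeries.constantCoeff_surj⟩

/-- The module `V[[h]] = 𝕜[[h]] ⊗ V` (here `V` is always finite-dimensional). -/
def Formal (𝕜 : Type*) [Field 𝕜] (V : Type*) [AddCommGroup V] [Module 𝕜 V] : Type _ :=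
  𝕜⟦X⟧ ⊗[𝕜] V

instance formalAddCommGroup (𝕜 : Type*) [Field 𝕜] (V : Type*) [AddCommGroup V] [Module 𝕜 V] :
    AddCommGroup (Formal 𝕜 V) :=
  inferInstanceAs (AddCommGroup (𝕜⟦X⟧ ⊗[𝕜] V))

instance formalModule (𝕜 : Type*) [Field 𝕜] (V : Type*) [AddCommGroup V] [Module 𝕜 V] :
    Module 𝕜⟦X⟧ (Formal 𝕜 V) :=
  inferInstanceAs (Module 𝕜⟦X⟧ (𝕜⟦X⟧ ⊗[𝕜] V))

/-- The element `f ⊗ v`, i.e. `f v`, of `V[[h]]`. -/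
def Formal.mk {𝕜 : Type*} [Field 𝕜] {V : Type*} [AddCommGroup V] [Module 𝕜 V] (f : 𝕜⟦X⟧) (v : V) :
    Formal 𝕜 V :=
  f ⊗ₜ[𝕜] v

/-- Setting `h = 0`: the map `V[[h]] → V`, `f ⊗ v ↦ f(0) v`. -/
def evalZero (𝕜 : Type*) [Field 𝕜] (V : Type*) [AddCommGroup V] [Module 𝕜 V] :
    Formal 𝕜 V →ₛₗ[(PowerSeries.constantCoeff : 𝕜⟦X⟧ →+* 𝕜)] V where
  toFun x := TensorProduct.lid 𝕜 V ((PowerSeries.coeff (R := 𝕜) 0).rTensor V x)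
  map_add' x y :=
    (congrArg (TensorProduct.lid 𝕜 V)
      (map_add ((PowerSeries.coeff (R := 𝕜) 0).rTensor V) (x : 𝕜⟦X⟧ ⊗[𝕜] V) y)).trans
      (map_add (TensorProduct.lid 𝕜 V) _ _)
  map_smul' c x := by
    change TensorProduct.lid 𝕜 V ((PowerSeries.coeff (R := 𝕜) 0).rTensor V
      (c • (show 𝕜⟦X⟧ ⊗[𝕜] V from x))) = PowerSeries.constantCoeff c •
        TensorProduct.lid 𝕜 V ((PowerSeries.coeff (R := 𝕜) 0).rTensor V
          (show 𝕜⟦X⟧ ⊗[𝕜] V from x))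
    induction (show 𝕜⟦X⟧ ⊗[𝕜] V from x) using TensorProduct.induction_on with
    | zero => simp
    | tmul f v => simp [TensorProduct.smul_tmul', mul_smul]
    | add x y hx hy => rw [smul_add, map_add, map_add, hx, hy, map_add, map_add, smul_add]

theorem evalZero_mk {V : Type*} [AddCommGroup V] [Module 𝕜 V] (f : 𝕜⟦X⟧) (v : V) :
    evalZero 𝕜 V (Formal.mk f v) = PowerSeries.constantCoeff f • v := by
  change TensorProduct.lid 𝕜 V ((PowerSeries.coeff (R := 𝕜) 0).rTensor V (f ⊗ₜ[𝕜] v)) = _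
  simp

/-- Setting `h = 0` in operators: an operator `φ` on `V[[h]]` goes to `v ↦ φ(v)|_{h = 0}`. -/
def evalZeroEnd (𝕜 : Type*) [Field 𝕜] (V : Type*) [AddCommGroup V] [Module 𝕜 V] :
    Module.End 𝕜⟦X⟧ (Formal 𝕜 V) →ₛₗ[(PowerSeries.constantCoeff : 𝕜⟦X⟧ →+* 𝕜)]
      Module.End 𝕜 V where
  toFun φ :=
    { toFun := fun v => evalZero 𝕜 V (φ (Formal.mk 1 v))
      map_add' := fun v w => by
        have h : (Formal.mk 1 (v + w) : Formal 𝕜 V) = Formal.mk 1 v + Formal.mk 1 w :=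
          TensorProduct.tmul_add _ _ _
        rw [h, map_add, map_add]
      map_smul' := fun c v => by
        have h : (Formal.mk 1 (c • v) : Formal 𝕜 V)
            = (PowerSeries.C c : 𝕜⟦X⟧) • Formal.mk 1 v := by
          change (1 : 𝕜⟦X⟧) ⊗ₜ[𝕜] (c • v) = (PowerSeries.C c : 𝕜⟦X⟧) • ((1 : 𝕜⟦X⟧) ⊗ₜ[𝕜] v)
          rw [TensorProduct.tmul_smul, TensorProduct.smul_tmul', TensorProduct.smul_tmul',
            PowerSeries.smul_eq_C_mul, smul_eq_mul]
        rw [h, map_smul, LinearMap.map_smulₛₗ]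
        simp }
  map_add' φ ψ := by ext v; simp
  map_smul' c φ := by
    ext v
    simp only [LinearMap.coe_mk, AddHom.coe_mk, LinearMap.smul_apply, LinearMap.map_smulₛₗ]

section

variable {E : Type*} [AddCommGroup E] [Module 𝕜 E]
  {Eh : Type*} [AddCommGroup Eh] [Module 𝕜⟦X⟧ Eh]

/-- With respect to the map `π : E_h → E` of setting `h = 0`, the submodule `J_h` of `E_h` is a
deformation of the subspace `J` of `E`: it is splitting and `J_0 = J`. -/
structure IsSubspaceDeformation (π : Eh →ₛₗ[(PowerSeries.constantCoeff : 𝕜⟦X⟧ →+* 𝕜)] E)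
    (Jh : Submodule 𝕜⟦X⟧ Eh) (J : Submodule 𝕜 E) : Prop where
  splitting : IsSplitting Jh
  map_eq : Jh.map π = J

/-- The operator `S_h` on `E_h` is a deformation of the operator `S` on `E`, i.e. `S_0 = S`. -/
def IsOperatorDeformation (π : Eh →ₛₗ[(PowerSeries.constantCoeff : 𝕜⟦X⟧ →+* 𝕜)] E)
    (Sh : Module.End 𝕜⟦X⟧ Eh) (S : Module.End 𝕜 E) : Prop :=
  ∀ x, π (Sh x) = S (π x)

/-- The quadratic algebra `(E_h, J_h)` over `𝕜[[h]]` is a deformation of the quadratic algebra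
`(E, J)` over `𝕜`: the module `E_h` is free of finite rank, `π` identifies `E_h / h E_h` with `E`,
and `J_h` is a splitting submodule of `E_h ⊗ E_h` with `J_0 = J`. -/
structure IsQuadDeformation (π : Eh →ₛₗ[(PowerSeries.constantCoeff : 𝕜⟦X⟧ →+* 𝕜)] E)
    (Jh : Submodule 𝕜⟦X⟧ (Eh ⊗[𝕜⟦X⟧] Eh)) (J : Submodule 𝕜 (E ⊗[𝕜] E)) : Prop where
  free : Module.Free 𝕜⟦X⟧ Eh
  finite : Module.Finite 𝕜⟦X⟧ Eh
  surjective : Function.Surjective π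
  eq_zero_iff : ∀ x, π x = 0 ↔ ∃ y, x = (PowerSeries.X : 𝕜⟦X⟧) • y
  deforms : IsSubspaceDeformation (TensorProduct.map π π) Jh J

/-- A deformation of quadratic algebras is flat if all homogeneous components of the deformed
algebra are free modules. -/
structure IsFlatDeformation (π : Eh →ₛₗ[(PowerSeries.constantCoeff : 𝕜⟦X⟧ →+* 𝕜)] E)
    (Jh : Submodule 𝕜⟦X⟧ (Eh ⊗[𝕜⟦X⟧] Eh)) (J : Submodule 𝕜 (E ⊗[𝕜] E)) : Prop extends
    IsQuadDeformation π Jh J where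
  flat : ∀ k : ℕ, Module.Free 𝕜⟦X⟧ (quadComponent Jh k)

end

end Deformations

end QuadDef

end

/-!
Throughout, `E_h → E` is a map that identifies `E` with `E_h / X E_h`, where `E_h` is a finite free
module over the discrete valuation ring `𝕜⟦X⟧` (`IsReduction`), and a submodule is splitting exactly
when it is saturated (`IsSaturated`). The hypothesis on `A_k(S_h)` enters in one way only: a
saturated algebra `B` of operators, generated by operators `s_i`, reduces modulo `X` to the algebra
`A` generated by the reductions of the `s_i` (`exists_adjoin_reduction`), which here is semisimple.
Idempotents of `A` lift to `B` (`IsAlgReduction.exists_idempotent_lift`).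

*Eigenvalues.* For `k = 2` the algebra `A` is `𝕜[S]`. As it is semisimple and the characteristic
polynomial of `S` splits, `S` is diagonalizable and its spectral projections lie in `A`. Their
lifts to `𝕜⟦X⟧[S_h]` are the spectral projections of `S_h` (`exists_spectralDecomposition_lift`),
and the differences of the eigenvalues of `S_h` are units, which gives uniqueness.

*Part a).* In degree `k` put `t_i = (S_h)_i - λ_{mh}`. Then `I_{mh}^{(k)}` is the common kernel of
the `t_i` and `J_{mh}^k` is the sum of their images. The left ideal of the semisimple algebra `A`
generated by the reductions of the `t_i` has codimension at most one and is generated by a central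
idempotent; the lift `e` of this idempotent to `B` is central. On `1 - e` each `t_i` acts by a
scalar divisible by `X`. The difference of two eigenvalues of `S_h` is zero or a unit, so that
`t_i q t_i = t_i` for some `q` in `B`, and such a scalar has to vanish
(`IsAlgReduction.exists_central_idempotent`). Hence the two submodules are the kernel and the image
of the projection `e`.

*Part b).* The component of degree `k` of the quadratic algebra `(W, J)` is `W^{⊗k} / J^k`
(`toTensorAlgebra_mem_quadIdeal_iff`), so that it is free if `J^k` is saturated
(`quadComponent_free`), and `J_{mh}^k` is a direct summand by a).

*Part c).* Under `End(W)^{⊗k} = End(W^{⊗k})` the relations of the quantum semigroup become the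
commutators with `S_h` (`map_semigroupRel`), and their `k`-th sum becomes
`∑_i [(S_h)_i, End(W^{⊗k})]`, the commutators with `B`. The regular trace form of `A` is
nondegenerate, as `A` is semisimple of characteristic zero; hence that of `B` is unimodular, and it
gives dual bases `b_i`, `c_i` of `B` with `∑ b_i c_i = 1`. The commutators with `B` are then the
kernel of `x ↦ ∑ c_i x b_i`, and a kernel with values in a free module is saturated
(`isSaturated_iSup_range_commutatorMap`).
-/

namespace QuadDef

open PowerSeries (constantCoeff)
open Module (Basis)

/-! ### Modules over the formal power series ring -/

section Nakayama

variable {𝕜 : Type*} [Field 𝕜] {M : Type*} [AddCommGroup M] [Module 𝕜⟦X⟧ M]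

/-- Nakayama's lemma over `𝕜⟦X⟧`, phrased elementwise. -/
theorem le_of_forall_eq_add_X_smul [Module.Finite 𝕜⟦X⟧ M] {N N' : Submodule 𝕜⟦X⟧ M}
    (h : ∀ x ∈ N, ∃ y ∈ N', ∃ z ∈ N, x = y + (PowerSeries.X : 𝕜⟦X⟧) • z) : N ≤ N' := by
  have hI : Ideal.span {(PowerSeries.X : 𝕜⟦X⟧)} ≤ Ideal.jacobson ⊥ := by
    rw [IsLocalRing.jacobson_eq_maximalIdeal ⊥ bot_ne_top, Ideal.span_singleton_le_iff_mem,
      IsLocalRing.mem_maximalIdeal, mem_nonunits_iff]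
    exact PowerSeries.X_prime.not_isUnit
  refine Submodule.le_of_le_smul_of_le_jacobson_bot (IsNoetherian.noetherian N) hI fun x hx => ?_
  obtain ⟨y, hy, z, hz, rfl⟩ := h x hx
  exact add_mem (Submodule.mem_sup_left hy) (Submodule.mem_sup_right
    (Submodule.smul_mem_smul (Ideal.mem_span_singleton_self _) hz))

/-- A finite free module over `𝕜⟦X⟧` is `X`-adically separated. -/
theorem eq_zero_of_forall_exists_X_pow_smul [Module.Free 𝕜⟦X⟧ M] {x : M}
    (h : ∀ n : ℕ, ∃ y : M, x = (PowerSeries.X : 𝕜⟦X⟧) ^ n • y) : x = 0 := by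
  refine (Module.Free.chooseBasis 𝕜⟦X⟧ M).ext_elem fun i => ?_
  ext n
  obtain ⟨y, hy⟩ := h (n + 1)
  rw [hy, map_smul, Finsupp.smul_apply, smul_eq_mul]
  simpa using PowerSeries.X_pow_dvd_iff.mp (Dvd.intro _ rfl) n n.lt_succ_self

theorem eq_zero_of_eq_X_smul_apply [Module.Free 𝕜⟦X⟧ M] (g : Module.End 𝕜⟦X⟧ M) {x : M}
    (h : x = (PowerSeries.X : 𝕜⟦X⟧) • g x) : x = 0 := by
  refine eq_zero_of_forall_exists_X_pow_smul (𝕜 := 𝕜) fun n => ⟨(g ^ n) x, ?_⟩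
  induction n with
  | zero => simp
  | succ n ih =>
    nth_rw 1 [ih]
    nth_rw 1 [h]
    rw [map_smul, smul_smul, ← pow_succ, ← Module.End.mul_apply, ← pow_succ]

/-- Convergence of `X`-adic Cauchy sequences in finite free modules. -/
theorem exists_X_adic_limit [Module.Free 𝕜⟦X⟧ M] [Module.Finite 𝕜⟦X⟧ M] (z : ℕ → M)
    (h : ∀ n, ∃ y, z (n + 1) - z n = (PowerSeries.X : 𝕜⟦X⟧) ^ (n + 1) • y) :
    ∃ e, ∀ n, ∃ y, e - z n = (PowerSeries.X : 𝕜⟦X⟧) ^ (n + 1) • y := by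
  classical
  let b := Module.Free.chooseBasis 𝕜⟦X⟧ M
  have hstep : ∀ i m n, m ≤ n →
      PowerSeries.coeff m (b.repr (z (n + 1)) i) = PowerSeries.coeff m (b.repr (z n) i) := by
    intro i m n hmn
    obtain ⟨y, hy⟩ := h n
    have := congrArg (fun w => PowerSeries.coeff m (b.repr w i)) hy
    simp only [map_sub, Finsupp.sub_apply, map_smul, Finsupp.smul_apply, smul_eq_mul] at this
    rw [PowerSeries.X_pow_dvd_iff.mp (Dvd.intro _ rfl) m (Nat.lt_succ_of_le hmn)] at this
    exact sub_eq_zero.mp this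
  have hconst : ∀ i m n, m ≤ n →
      PowerSeries.coeff m (b.repr (z n) i) = PowerSeries.coeff m (b.repr (z m) i) := by
    intro i m n hmn
    induction n, hmn using Nat.le_induction with
    | base => rfl
    | succ n hmn ih => rw [hstep i m n hmn, ih]
  let e : M := ∑ i, (PowerSeries.mk fun m => PowerSeries.coeff m (b.repr (z m) i)) • b i
  have he : ∀ i, b.repr e i = PowerSeries.mk fun m => PowerSeries.coeff m (b.repr (z m) i) := by
    intro i
    rw [b.repr_sum_self]
  refine ⟨e, fun n => ?_⟩
  have hdvd : ∀ i, (PowerSeries.X : 𝕜⟦X⟧) ^ (n + 1) ∣ b.repr (e - z n) i := by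
    intro i
    rw [PowerSeries.X_pow_dvd_iff]
    intro m hm
    rw [map_sub, Finsupp.sub_apply, map_sub, he, PowerSeries.coeff_mk,
      hconst i m n (Nat.lt_succ_iff.mp hm), sub_self]
  choose c hc using hdvd
  refine ⟨∑ i, c i • b i, b.ext_elem fun i => ?_⟩
  rw [map_smul, Finsupp.smul_apply, b.repr_sum_self, hc, smul_eq_mul]

/-- A submodule is saturated if it contains every element of which it contains a nonzero
multiple. -/
def IsSaturated {R : Type*} [CommRing R] {M : Type*} [AddCommGroup M] [Module R M]
    (N : Submodule R M) : Prop :=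
  ∀ (r : R) (x : M), r ≠ 0 → r • x ∈ N → x ∈ N

theorem IsSplitting.isSaturated {R : Type*} [CommRing R] [IsDomain R] {M : Type*} [AddCommGroup M]
    [Module R M] [Module.IsTorsionFree R M] {N : Submodule R M} (h : IsSplitting N) :
    IsSaturated N := by
  obtain ⟨C, hC⟩ := h
  intro r x hr hx
  obtain ⟨b, hb, c, hc, rfl⟩ : ∃ b ∈ N, ∃ c ∈ C, b + c = x :=
    Submodule.mem_sup.mp (hC.sup_eq_top ▸ Submodule.mem_top)
  have h1 : r • c ∈ N := by
    have := sub_mem hx (N.smul_mem r hb)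
    rwa [smul_add, add_sub_cancel_left] at this
  have h2 : r • c = 0 := Submodule.disjoint_def.mp hC.disjoint _ h1 (C.smul_mem r hc)
  rw [(smul_eq_zero.mp h2).resolve_left hr, add_zero]
  exact hb

theorem isSaturated_bot {R : Type*} [CommRing R] [IsDomain R] {M : Type*} [AddCommGroup M]
    [Module R M] [Module.IsTorsionFree R M] : IsSaturated (⊥ : Submodule R M) := by
  intro r x hr hx
  exact (smul_eq_zero.mp hx).resolve_left hr

end Nakayama

/-! ### Reduction modulo `X` -/

section Reduction

variable {𝕜 : Type*} [Field 𝕜]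
  {E : Type*} [AddCommGroup E] [Module 𝕜 E] {Eh : Type*} [AddCommGroup Eh] [Module 𝕜⟦X⟧ Eh]
  {F : Type*} [AddCommGroup F] [Module 𝕜 F] {Fh : Type*} [AddCommGroup Fh] [Module 𝕜⟦X⟧ Fh]

/-- The map `π` identifies `E` with the quotient `E_h / X E_h`. -/
structure IsReduction (π : Eh →ₛₗ[(constantCoeff : 𝕜⟦X⟧ →+* 𝕜)] E) : Prop where
  surjective : Function.Surjective π
  eq_zero_iff : ∀ x, π x = 0 ↔ ∃ y, x = (PowerSeries.X : 𝕜⟦X⟧) • y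

variable {π : Eh →ₛₗ[(constantCoeff : 𝕜⟦X⟧ →+* 𝕜)] E}

theorem IsReduction.exists_sub_eq (hπ : IsReduction π) {x y : Eh} (h : π x = π y) :
    ∃ z, x - y = (PowerSeries.X : 𝕜⟦X⟧) • z :=
  (hπ.eq_zero_iff _).mp (by rw [map_sub, h, sub_self])

theorem repr_reduction {ι : Type*} [Finite ι] {bh : Basis ι 𝕜⟦X⟧ Eh} {b : Basis ι 𝕜 E}
    (h : ∀ i, b i = π (bh i)) (x : Eh) (i : ι) :
    b.repr (π x) i = constantCoeff (bh.repr x i) := by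
  cases nonempty_fintype ι
  conv_lhs => rw [← bh.sum_repr x]
  simp only [map_sum, LinearMap.map_smulₛₗ, ← h]
  rw [← map_sum, b.repr_sum_self]

theorem isReduction_of_basis {ι : Type*} [Finite ι] (bh : Basis ι 𝕜⟦X⟧ Eh) (b : Basis ι 𝕜 E)
    (h : ∀ i, π (bh i) = b i) : IsReduction π := by
  cases nonempty_fintype ι
  refine ⟨fun y => ⟨∑ i, PowerSeries.C (b.repr y i) • bh i, ?_⟩, fun x => ⟨fun hx => ?_, ?_⟩⟩
  · simp only [map_sum, LinearMap.map_smulₛₗ, h, PowerSeries.constantCoeff_C]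
    exact b.sum_repr y
  · have hd : ∀ i, (PowerSeries.X : 𝕜⟦X⟧) ∣ bh.repr x i := by
      intro i
      rw [PowerSeries.X_dvd_iff, ← repr_reduction (fun i => (h i).symm), hx]
      simp
    choose c hc using hd
    refine ⟨∑ i, c i • bh i, bh.ext_elem fun i => ?_⟩
    rw [map_smul, Finsupp.smul_apply, bh.repr_sum_self, hc, smul_eq_mul]
  · rintro ⟨y, rfl⟩
    simp

/-- The reductions of the elements of a basis form a basis. -/
theorem IsReduction.exists_basis (hπ : IsReduction π) {ι : Type*} [Finite ι]
    (bh : Basis ι 𝕜⟦X⟧ Eh) : ∃ b : Basis ι 𝕜 E, ∀ i, b i = π (bh i) := by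
  cases nonempty_fintype ι
  have hli : LinearIndependent 𝕜 fun i => π (bh i) := by
    rw [Fintype.linearIndependent_iff]
    intro g hg i
    have h0 : π (∑ i, PowerSeries.C (g i) • bh i) = 0 := by
      simpa only [map_sum, LinearMap.map_smulₛₗ, PowerSeries.constantCoeff_C] using hg
    obtain ⟨y, hy⟩ := (hπ.eq_zero_iff _).mp h0
    have := congrArg (fun w => constantCoeff (bh.repr w i)) hy
    simp only [bh.repr_sum_self] at this
    simpa using this
  have hsp : ⊤ ≤ Submodule.span 𝕜 (Set.range fun i => π (bh i)) := by
    rintro y -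
    obtain ⟨x, rfl⟩ := hπ.surjective y
    rw [← bh.sum_repr x, map_sum]
    refine Submodule.sum_mem _ fun i _ => ?_
    rw [LinearMap.map_smulₛₗ]
    exact Submodule.smul_mem _ _ (Submodule.subset_span ⟨i, rfl⟩)
  exact ⟨Basis.mk hli hsp, fun i => Basis.mk_apply hli hsp i⟩

theorem IsReduction.tensorProduct {π' : Fh →ₛₗ[(constantCoeff : 𝕜⟦X⟧ →+* 𝕜)] F}
    [Module.Free 𝕜⟦X⟧ Eh] [Module.Finite 𝕜⟦X⟧ Eh] [Module.Free 𝕜⟦X⟧ Fh] [Module.Finite 𝕜⟦X⟧ Fh]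
    (hπ : IsReduction π) (hπ' : IsReduction π') : IsReduction (TensorProduct.map π π') := by
  obtain ⟨b, hb⟩ := hπ.exists_basis (Module.Free.chooseBasis 𝕜⟦X⟧ Eh)
  obtain ⟨b', hb'⟩ := hπ'.exists_basis (Module.Free.chooseBasis 𝕜⟦X⟧ Fh)
  refine isReduction_of_basis ((Module.Free.chooseBasis 𝕜⟦X⟧ Eh).tensorProduct
    (Module.Free.chooseBasis 𝕜⟦X⟧ Fh)) (b.tensorProduct b') ?_
  rintro ⟨i, j⟩
  simp [hb, hb']

/-- Tensor powers of a reduction. -/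
theorem IsReduction.exists_tensorPower [Module.Free 𝕜⟦X⟧ Eh] [Module.Finite 𝕜⟦X⟧ Eh]
    (hπ : IsReduction π) (k : ℕ) :
    ∃ πk : (⨂[𝕜⟦X⟧]^k Eh) →ₛₗ[(constantCoeff : 𝕜⟦X⟧ →+* 𝕜)] ⨂[𝕜]^k E, IsReduction πk ∧
      ∀ x : Fin k → Eh, πk (PiTensorProduct.tprod 𝕜⟦X⟧ x) =
        PiTensorProduct.tprod 𝕜 fun i => π (x i) := by
  classical
  let bh := Module.Free.chooseBasis 𝕜⟦X⟧ Eh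
  obtain ⟨b, hb⟩ := hπ.exists_basis bh
  let Bh := Basis.piTensorProduct fun _ : Fin k => bh
  let B := Basis.piTensorProduct fun _ : Fin k => b
  let πk : (⨂[𝕜⟦X⟧]^k Eh) →ₛₗ[(constantCoeff : 𝕜⟦X⟧ →+* 𝕜)] ⨂[𝕜]^k E :=
    { toFun := fun x => ∑ p, constantCoeff (Bh.repr x p) • B p
      map_add' := fun x y => by simp [add_smul, Finset.sum_add_distrib]
      map_smul' := fun r x => by simp [mul_smul, Finset.smul_sum] }
  have hk : ∀ x p, B.repr (πk x) p = constantCoeff (Bh.repr x p) := by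
    intro x p
    exact congrFun (B.repr_sum_self fun p => constantCoeff (Bh.repr x p)) p
  have hB : ∀ p, πk (Bh p) = B p := by
    intro p
    refine B.ext_elem fun q => ?_
    rw [hk, Basis.repr_self, Basis.repr_self, Finsupp.single_apply, Finsupp.single_apply]
    split_ifs <;> simp
  refine ⟨πk, isReduction_of_basis Bh B hB, fun x => B.ext_elem fun p => ?_⟩
  rw [hk, Basis.piTensorProduct_repr_tprod_apply, Basis.piTensorProduct_repr_tprod_apply, map_prod]
  exact Finset.prod_congr rfl fun i _ => (repr_reduction hb _ _).symm

end Reduction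

/-! ### Reduction of operators and of algebras of operators -/

section EndReduction

variable {𝕜 : Type*} [Field 𝕜]
  {E : Type*} [AddCommGroup E] [Module 𝕜 E] {Eh : Type*} [AddCommGroup Eh] [Module 𝕜⟦X⟧ Eh]
  {π : Eh →ₛₗ[(constantCoeff : 𝕜⟦X⟧ →+* 𝕜)] E}

theorem IsReduction.apply_eq_of_eq (hπ : IsReduction π) (φ : Module.End 𝕜⟦X⟧ Eh) {x y : Eh}
    (h : π x = π y) : π (φ x) = π (φ y) := by
  obtain ⟨z, hz⟩ := hπ.exists_sub_eq h
  rw [← sub_eq_zero, ← map_sub, ← map_sub, hz]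
  simp

/-- The operator on `E = E_h / X E_h` induced by an operator on `E_h`, as a semilinear map. -/
noncomputable def IsReduction.endMap (hπ : IsReduction π) :
    Module.End 𝕜⟦X⟧ Eh →ₛₗ[(constantCoeff : 𝕜⟦X⟧ →+* 𝕜)] Module.End 𝕜 E where
  toFun φ :=
    { toFun := fun v => π (φ (Function.surjInv hπ.surjective v))
      map_add' := fun v w => by
        rw [← map_add, ← map_add]
        exact hπ.apply_eq_of_eq φ (by simp [Function.surjInv_eq])
      map_smul' := fun c v => by
        have : c • π (φ (Function.surjInv hπ.surjective v)) =
            π (φ ((PowerSeries.C c : 𝕜⟦X⟧) • Function.surjInv hπ.surjective v)) := by simp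
        rw [RingHom.id_apply, this]
        exact hπ.apply_eq_of_eq φ (by simp [Function.surjInv_eq]) }
  map_add' φ ψ := by ext; simp
  map_smul' c φ := by ext; simp

theorem IsReduction.isOperatorDeformation_endMap (hπ : IsReduction π)
    (φ : Module.End 𝕜⟦X⟧ Eh) : IsOperatorDeformation π φ (hπ.endMap φ) := fun x =>
  hπ.apply_eq_of_eq φ (Function.surjInv_eq hπ.surjective (π x)).symm

theorem IsReduction.endMap_eq (hπ : IsReduction π) {φ : Module.End 𝕜⟦X⟧ Eh} {ψ : Module.End 𝕜 E}
    (h : IsOperatorDeformation π φ ψ) : hπ.endMap φ = ψ := by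
  ext v
  obtain ⟨x, rfl⟩ := hπ.surjective v
  rw [← hπ.isOperatorDeformation_endMap, h]

theorem IsReduction.endMap_one (hπ : IsReduction π) : hπ.endMap 1 = 1 :=
  hπ.endMap_eq fun _ => rfl

theorem IsReduction.endMap_mul (hπ : IsReduction π) (φ ψ : Module.End 𝕜⟦X⟧ Eh) :
    hπ.endMap (φ * ψ) = hπ.endMap φ * hπ.endMap ψ :=
  hπ.endMap_eq fun x => by
    rw [Module.End.mul_apply, Module.End.mul_apply, hπ.isOperatorDeformation_endMap,
      hπ.isOperatorDeformation_endMap]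

theorem IsReduction.endMap_isReduction [Module.Free 𝕜⟦X⟧ Eh] (hπ : IsReduction π) :
    IsReduction hπ.endMap := by
  refine ⟨fun ψ => ?_, fun φ => ⟨fun h => ?_, ?_⟩⟩
  · let b := Module.Free.chooseBasis 𝕜⟦X⟧ Eh
    refine ⟨b.constr 𝕜⟦X⟧ fun i => Function.surjInv hπ.surjective (ψ (π (b i))),
      hπ.endMap_eq fun x => ?_⟩
    induction b.mem_span x using Submodule.span_induction with
    | mem x hx =>
      obtain ⟨i, rfl⟩ := hx
      rw [Basis.constr_basis, Function.surjInv_eq hπ.surjective]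
    | zero => simp
    | add x y _ _ hx hy => simp only [map_add, hx, hy]
    | smul c x _ hx => simp only [map_smul, LinearMap.map_smulₛₗ, hx]
  · have hx : ∀ x, ∃ y, φ x = (PowerSeries.X : 𝕜⟦X⟧) • y := fun x =>
      (hπ.eq_zero_iff _).mp (by rw [hπ.isOperatorDeformation_endMap, h, LinearMap.zero_apply])
    choose g hg using hx
    have hinj : ∀ {x y : Eh}, (PowerSeries.X : 𝕜⟦X⟧) • x = (PowerSeries.X : 𝕜⟦X⟧) • y → x = y :=
      fun h => smul_right_injective _ PowerSeries.X_ne_zero h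
    refine ⟨{ toFun := g, map_add' := fun x y => hinj ?_, map_smul' := fun c x => hinj ?_ }, ?_⟩
    · rw [smul_add, ← hg, ← hg, ← hg, map_add]
    · rw [RingHom.id_apply, smul_comm, ← hg, ← hg, map_smul]
    · ext x
      exact hg x
  · rintro ⟨ψ, rfl⟩
    simp

end EndReduction

section AlgReduction

variable {𝕜 : Type*} [Field 𝕜] {A : Type*} [Ring A] [Algebra 𝕜 A] {B : Type*} [Ring B]
  [Algebra 𝕜⟦X⟧ B]

/-- A reduction modulo `X` which is a homomorphism of rings. -/
structure IsAlgReduction (ρ : B →ₛₗ[(constantCoeff : 𝕜⟦X⟧ →+* 𝕜)] A) : Prop extends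
    IsReduction ρ where
  map_one : ρ 1 = 1
  map_mul : ∀ x y, ρ (x * y) = ρ x * ρ y

end AlgReduction

section Subalgebra

variable {𝕜 : Type*} [Field 𝕜]
  {E : Type*} [AddCommGroup E] [Module 𝕜 E] {Eh : Type*} [AddCommGroup Eh] [Module 𝕜⟦X⟧ Eh]
  {π : Eh →ₛₗ[(constantCoeff : 𝕜⟦X⟧ →+* 𝕜)] E}

/-- If operators on `E_h` generate a saturated subalgebra of `End(E_h)`, then this subalgebra
reduces modulo `X` to the subalgebra generated by the reduced operators. -/
theorem exists_adjoin_reduction [Module.Free 𝕜⟦X⟧ Eh] (hπ : IsReduction π) {ι : Type*}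
    {sh : ι → Module.End 𝕜⟦X⟧ Eh} {s : ι → Module.End 𝕜 E}
    (hs : ∀ i, IsOperatorDeformation π (sh i) (s i))
    (hsat : IsSaturated (Subalgebra.toSubmodule (Algebra.adjoin 𝕜⟦X⟧ (Set.range sh)))) :
    ∃ ρ : Algebra.adjoin 𝕜⟦X⟧ (Set.range sh) →ₛₗ[(constantCoeff : 𝕜⟦X⟧ →+* 𝕜)]
      Algebra.adjoin 𝕜 (Set.range s), IsAlgReduction ρ ∧
        ∀ x : Algebra.adjoin 𝕜⟦X⟧ (Set.range sh),
          IsOperatorDeformation π (x : Module.End 𝕜⟦X⟧ Eh) (ρ x : Module.End 𝕜 E) := by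
  have hmem : ∀ x ∈ Algebra.adjoin 𝕜⟦X⟧ (Set.range sh),
      hπ.endMap x ∈ Algebra.adjoin 𝕜 (Set.range s) := by
    intro x hx
    induction hx using Algebra.adjoin_induction with
    | mem x hx =>
      obtain ⟨i, rfl⟩ := hx
      rw [hπ.endMap_eq (hs i)]
      exact Algebra.subset_adjoin ⟨i, rfl⟩
    | algebraMap r =>
      rw [Algebra.algebraMap_eq_smul_one, LinearMap.map_smulₛₗ, hπ.endMap_one,
        ← Algebra.algebraMap_eq_smul_one]
      exact Subalgebra.algebraMap_mem _ _
    | add x y _ _ hx hy => rw [map_add]; exact add_mem hx hy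
    | mul x y _ _ hx hy => rw [hπ.endMap_mul]; exact mul_mem hx hy
  have hsurj : ∀ y ∈ Algebra.adjoin 𝕜 (Set.range s),
      ∃ x ∈ Algebra.adjoin 𝕜⟦X⟧ (Set.range sh), hπ.endMap x = y := by
    intro y hy
    induction hy using Algebra.adjoin_induction with
    | mem x hx =>
      obtain ⟨i, rfl⟩ := hx
      exact ⟨sh i, Algebra.subset_adjoin ⟨i, rfl⟩, hπ.endMap_eq (hs i)⟩
    | algebraMap r =>
      refine ⟨algebraMap _ _ (PowerSeries.C r), Subalgebra.algebraMap_mem _ _, ?_⟩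
      rw [Algebra.algebraMap_eq_smul_one, LinearMap.map_smulₛₗ, hπ.endMap_one,
        PowerSeries.constantCoeff_C, ← Algebra.algebraMap_eq_smul_one]
    | add x y _ _ hx hy =>
      obtain ⟨x, hx, rfl⟩ := hx
      obtain ⟨y, hy, rfl⟩ := hy
      exact ⟨x + y, add_mem hx hy, map_add _ _ _⟩
    | mul x y _ _ hx hy =>
      obtain ⟨x, hx, rfl⟩ := hx
      obtain ⟨y, hy, rfl⟩ := hy
      exact ⟨x * y, mul_mem hx hy, hπ.endMap_mul _ _⟩
  let ρ : Algebra.adjoin 𝕜⟦X⟧ (Set.range sh) →ₛₗ[(constantCoeff : 𝕜⟦X⟧ →+* 𝕜)]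
      Algebra.adjoin 𝕜 (Set.range s) :=
    { toFun := fun x => ⟨hπ.endMap x, hmem x x.2⟩
      map_add' := fun x y => Subtype.ext (map_add hπ.endMap _ _)
      map_smul' := fun r x => Subtype.ext (LinearMap.map_smulₛₗ hπ.endMap _ _) }
  refine ⟨ρ, ⟨⟨?_, ?_⟩, ?_, ?_⟩, ?_⟩
  · rintro ⟨y, hy⟩
    obtain ⟨x, hx, rfl⟩ := hsurj y hy
    exact ⟨⟨x, hx⟩, rfl⟩
  · intro x
    refine ⟨fun h => ?_, ?_⟩
    · obtain ⟨y, hy⟩ := (hπ.endMap_isReduction.eq_zero_iff x).mp (congrArg Subtype.val h)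
      exact ⟨⟨y, hsat _ y PowerSeries.X_ne_zero (hy ▸ x.2)⟩, Subtype.ext hy⟩
    · rintro ⟨y, rfl⟩
      simp
  · exact Subtype.ext hπ.endMap_one
  · exact fun x y => Subtype.ext (hπ.endMap_mul _ _)
  · exact fun x => hπ.isOperatorDeformation_endMap _

end Subalgebra

/-! ### Lifting idempotents -/

section Idempotents

variable {𝕜 : Type*} [Field 𝕜] {A : Type*} [Ring A] [Algebra 𝕜 A] {B : Type*} [Ring B]
  [Algebra 𝕜⟦X⟧ B] {ρ : B →ₛₗ[(constantCoeff : 𝕜⟦X⟧ →+* 𝕜)] A}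

/-- Idempotents lift along a reduction of finite free algebras: Newton's iteration
`z ↦ 3z² - 2z³` converges. -/
theorem IsAlgReduction.exists_idempotent_lift [Module.Free 𝕜⟦X⟧ B] [Module.Finite 𝕜⟦X⟧ B]
    (hρ : IsAlgReduction ρ) {f : A} (hf : IsIdempotentElem f) :
    ∃ e : B, IsIdempotentElem e ∧ ρ e = f := by
  obtain ⟨z₀, hz₀⟩ := hρ.surjective f
  let z : ℕ → B := fun n => (fun w : B => 3 * w ^ 2 - 2 * w ^ 3)^[n] z₀
  have hz : ∀ n, z (n + 1) = 3 * z n ^ 2 - 2 * z n ^ 3 := fun n =>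
    Function.iterate_succ_apply' _ _ _
  have hid : ∀ n, ∃ y, z n ^ 2 - z n = (PowerSeries.X : 𝕜⟦X⟧) ^ (n + 1) • y := by
    intro n
    induction n with
    | zero =>
      obtain ⟨y, hy⟩ := (hρ.eq_zero_iff (z₀ ^ 2 - z₀)).mp (by
        rw [map_sub, sq, hρ.map_mul, hz₀, hf.eq, sub_self])
      exact ⟨y, by simpa [z] using hy⟩
    | succ n ih =>
      obtain ⟨y, hy⟩ := ih
      -- the error of the iterate is divisible by the square of the previous error
      have key : z (n + 1) ^ 2 - z (n + 1) =
          (z n ^ 2 - z n) * (z n ^ 2 - z n) * (4 * z n ^ 2 - 4 * z n - 3) := by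
        rw [hz]
        noncomm_ring
      refine ⟨(PowerSeries.X : 𝕜⟦X⟧) ^ n • (y * y * (4 * z n ^ 2 - 4 * z n - 3)), ?_⟩
      rw [key, hy, smul_mul_smul_comm, smul_mul_assoc, smul_smul, ← pow_add, ← pow_add]
      congr 2
      ring
  obtain ⟨e, he⟩ := exists_X_adic_limit (𝕜 := 𝕜) z fun n => by
    obtain ⟨y, hy⟩ := hid n
    refine ⟨y * (1 - 2 * z n), ?_⟩
    rw [← smul_mul_assoc, ← hy, hz]
    noncomm_ring
  refine ⟨e, sub_eq_zero.mp (eq_zero_of_forall_exists_X_pow_smul (𝕜 := 𝕜) fun n => ?_), ?_⟩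
  · obtain ⟨u, hu⟩ := he n
    obtain ⟨v, hv⟩ := hid n
    have hsplit : e * e - e = (e - z n) * e + z n * (e - z n) + (z n ^ 2 - z n) - (e - z n) := by
      noncomm_ring
    refine ⟨(PowerSeries.X : 𝕜⟦X⟧) • (u * e + z n * u + v - u), ?_⟩
    rw [hsplit, hu, hv, smul_smul, ← pow_succ]
    simp only [smul_add, smul_sub, smul_mul_assoc, mul_smul_comm]
  · obtain ⟨u, hu⟩ := he 0
    have : ρ (e - z₀) = 0 := (hρ.eq_zero_iff _).mpr ⟨u, by simpa [z] using hu⟩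
    rw [← hz₀]
    exact sub_eq_zero.mp (by rw [← map_sub, this])

theorem IsAlgReduction.eq_zero_of_idempotent [Module.Free 𝕜⟦X⟧ B] (hρ : IsAlgReduction ρ) {e : B}
    (he : IsIdempotentElem e) (h : ρ e = 0) : e = 0 := by
  obtain ⟨y, hy⟩ := (hρ.eq_zero_iff e).mp h
  refine eq_zero_of_eq_X_smul_apply (LinearMap.mulLeft 𝕜⟦X⟧ y) ?_
  rw [LinearMap.mulLeft_apply, ← smul_mul_assoc, ← hy, he.eq]

/-- If the reduction of an idempotent `f` spans a left ideal which is a line, then so does `f`. -/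
theorem IsAlgReduction.exists_mul_eq_smul [Module.Finite 𝕜⟦X⟧ B] (hρ : IsAlgReduction ρ) {f : B}
    (hf : IsIdempotentElem f) (h : ∀ a : A, ∃ c : 𝕜, a * ρ f = c • ρ f) (b : B) :
    ∃ r : 𝕜⟦X⟧, b * f = r • f := by
  have hle : LinearMap.range (LinearMap.mulRight 𝕜⟦X⟧ f) ≤ Submodule.span 𝕜⟦X⟧ {f} := by
    refine le_of_forall_eq_add_X_smul ?_
    rintro _ ⟨b, rfl⟩
    obtain ⟨c, hc⟩ := h (ρ b)
    obtain ⟨y, hy⟩ := hρ.exists_sub_eq (x := b * f) (y := (PowerSeries.C c : 𝕜⟦X⟧) • f) (by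
      rw [hρ.map_mul, hc, LinearMap.map_smulₛₗ, PowerSeries.constantCoeff_C])
    refine ⟨(PowerSeries.C c : 𝕜⟦X⟧) • f,
      Submodule.smul_mem _ _ (Submodule.mem_span_singleton_self f), y * f, ⟨y, rfl⟩, ?_⟩
    rw [← smul_mul_assoc, ← hy, sub_mul, mul_assoc, hf.eq, smul_mul_assoc, hf.eq,
      LinearMap.mulRight_apply, add_sub_cancel]
  obtain ⟨r, hr⟩ := Submodule.mem_span_singleton.mp (hle ⟨b, rfl⟩)
  exact ⟨r, hr.symm⟩

theorem IsAlgReduction.corner_eq_zero [Module.Finite 𝕜⟦X⟧ B] (hρ : IsAlgReduction ρ) {e f : B}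
    (he : IsIdempotentElem e) (hf : IsIdempotentElem f) (h : ∀ a : A, ρ e * a * ρ f = 0) (b : B) :
    e * b * f = 0 := by
  let g : Module.End 𝕜⟦X⟧ B := LinearMap.mulRight 𝕜⟦X⟧ f ∘ₗ LinearMap.mulLeft 𝕜⟦X⟧ e
  have hle : LinearMap.range g ≤ ⊥ := by
    refine le_of_forall_eq_add_X_smul ?_
    rintro _ ⟨b, rfl⟩
    obtain ⟨y, hy⟩ := (hρ.eq_zero_iff (e * b * f)).mp (by rw [hρ.map_mul, hρ.map_mul, h])
    refine ⟨0, zero_mem _, e * y * f, ⟨y, rfl⟩, ?_⟩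
    change e * b * f = _
    rw [zero_add, ← smul_mul_assoc, ← mul_smul_comm, ← hy]
    simp only [← mul_assoc, he.eq]
    rw [mul_assoc (e * b), hf.eq]
  exact (Submodule.mem_bot _).mp (hle ⟨b, rfl⟩)

end Idempotents

/-! ### The trivial isotypic part -/

section Central

/-- In a semisimple ring, an element `x` with `x y x = 0` for all `y` vanishes. -/
theorem eq_zero_of_forall_mul_mul_eq_zero {A : Type*} [Ring A] [IsSemisimpleRing A] {x : A}
    (h : ∀ y, x * y * x = 0) : x = 0 := by
  obtain ⟨e, he, hI⟩ := IsSemisimpleRing.ideal_eq_span_idempotent (Ideal.span {x})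
  obtain ⟨a, ha⟩ := Ideal.mem_span_singleton'.mp (hI ▸ Ideal.mem_span_singleton_self e)
  obtain ⟨c, hc⟩ := Ideal.mem_span_singleton'.mp (hI ▸ Ideal.mem_span_singleton_self x)
  have : e = 0 := by
    rw [← he.eq, ← ha, mul_assoc, ← mul_assoc x, h, mul_zero]
  rw [← hc, this, mul_zero]

variable {𝕜 : Type*} [Field 𝕜] {A : Type*} [Ring A] [Algebra 𝕜 A] {B : Type*} [Ring B]
  [Algebra 𝕜⟦X⟧ B] {ρ : B →ₛₗ[(constantCoeff : 𝕜⟦X⟧ →+* 𝕜)] A}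

/-- Let `A` be semisimple and generated by elements `τ_i`. The left ideal that they generate is
generated by a central idempotent, whose complement spans a line or vanishes. -/
theorem exists_idempotent_of_adjoin_eq_top [IsSemisimpleRing A] {ι : Type*} (τ : ι → A)
    (hτ : Algebra.adjoin 𝕜 (Set.range τ) = ⊤) :
    ∃ e : A, IsIdempotentElem e ∧ e ∈ Ideal.span (Set.range τ) ∧ (∀ i, τ i * (1 - e) = 0) ∧
      (∀ a, ∃ c : 𝕜, a * (1 - e) = c • (1 - e)) ∧ (∀ a, e * a * (1 - e) = 0) ∧
      ∀ a, (1 - e) * a * e = 0 := by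
  obtain ⟨e, he, hI⟩ := IsSemisimpleRing.ideal_eq_span_idempotent (Ideal.span (Set.range τ))
  have hN : ∀ n ∈ Ideal.span (Set.range τ), n * (1 - e) = 0 := by
    intro n hn
    rw [hI] at hn
    obtain ⟨a, rfl⟩ := Ideal.mem_span_singleton'.mp hn
    rw [mul_sub, mul_one, mul_assoc, he.eq, sub_self]
  have hA : ∀ a : A, ∃ c : 𝕜, a - algebraMap 𝕜 A c ∈ Ideal.span (Set.range τ) := by
    intro a
    have ha : a ∈ Algebra.adjoin 𝕜 (Set.range τ) := hτ ▸ Algebra.mem_top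
    induction ha using Algebra.adjoin_induction with
    | mem x hx => exact ⟨0, by simpa using Ideal.subset_span hx⟩
    | algebraMap r => exact ⟨r, by simp⟩
    | add x y _ _ hx hy =>
      obtain ⟨c, hc⟩ := hx
      obtain ⟨d, hd⟩ := hy
      exact ⟨c + d, by rw [map_add, add_sub_add_comm]; exact add_mem hc hd⟩
    | mul x y _ _ hx hy =>
      obtain ⟨c, hc⟩ := hx
      obtain ⟨d, hd⟩ := hy
      refine ⟨c * d, ?_⟩
      have : x * y - algebraMap 𝕜 A (c * d) =
          x * (y - algebraMap 𝕜 A d) + algebraMap 𝕜 A d * (x - algebraMap 𝕜 A c) := by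
        rw [mul_sub, mul_sub, ← Algebra.commutes d x, ← map_mul, mul_comm d c]
        abel
      rw [this]
      exact add_mem (Ideal.mul_mem_left _ _ hd) (Ideal.mul_mem_left _ _ hc)
  have hline : ∀ a, ∃ c : 𝕜, a * (1 - e) = c • (1 - e) := by
    intro a
    obtain ⟨c, hc⟩ := hA a
    refine ⟨c, ?_⟩
    have := hN _ hc
    rwa [sub_mul, sub_eq_zero, ← Algebra.smul_def] at this
  have h1 : ∀ a, e * a * (1 - e) = 0 := by
    intro a
    obtain ⟨c, hc⟩ := hline a
    rw [mul_assoc, hc, mul_smul_comm, mul_sub, mul_one, he.eq, sub_self, smul_zero]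
  refine ⟨e, he, hI ▸ Ideal.mem_span_singleton_self e, fun i => hN _ (Ideal.subset_span ⟨i, rfl⟩),
    hline, h1, fun a => eq_zero_of_forall_mul_mul_eq_zero fun y => ?_⟩
  have : (1 - e) * a * e * y * ((1 - e) * a * e) = (1 - e) * a * (e * y * (1 - e)) * a * e := by
    simp only [mul_assoc]
  rw [this, h1]
  simp

/-- Let `B → A` be a reduction with `A` semisimple, and let `t_i` be von Neumann regular elements of
`B` the reductions of which generate the algebra `A`. Then the left ideal generated by the `t_i` is
generated by a central idempotent. -/
theorem IsAlgReduction.exists_central_idempotent [Module.Free 𝕜⟦X⟧ B] [Module.Finite 𝕜⟦X⟧ B]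
    [IsSemisimpleRing A] (hρ : IsAlgReduction ρ) {ι : Type*} (t : ι → B)
    (ht : Algebra.adjoin 𝕜 (Set.range fun i => ρ (t i)) = ⊤)
    (hreg : ∀ i, ∃ q, t i * q * t i = t i) :
    ∃ e : B, IsIdempotentElem e ∧ (∀ b, e * b = b * e) ∧ (∀ i, t i * e = t i) ∧
      e ∈ Ideal.span (Set.range t) := by
  obtain ⟨e₀, he₀, hmem, hτ, hline, h1, h2⟩ :=
    exists_idempotent_of_adjoin_eq_top (fun i => ρ (t i)) ht
  obtain ⟨e, he, rfl⟩ := hρ.exists_idempotent_lift he₀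
  have hρf : ρ (1 - e) = 1 - ρ e := by rw [map_sub, hρ.map_one]
  have hcomm : ∀ b, e * b = b * e := by
    intro b
    have h3 := hρ.corner_eq_zero he he.one_sub (by simpa only [hρf] using h1) b
    have h4 := hρ.corner_eq_zero he.one_sub he (by simpa only [hρf] using h2) b
    rw [mul_sub, mul_one, sub_eq_zero] at h3
    rw [sub_mul, sub_mul, one_mul, sub_eq_zero] at h4
    rw [h3, h4]
  have hte : ∀ i, t i * e = t i := by
    intro i
    obtain ⟨y, hy⟩ := (hρ.eq_zero_iff (t i * (1 - e))).mp (by rw [hρ.map_mul, hρf, hτ])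
    obtain ⟨s, hs⟩ := hρ.exists_mul_eq_smul he.one_sub (by simpa only [hρf] using hline) y
    have htf : t i * (1 - e) = (PowerSeries.X * s) • (1 - e) := by
      rw [mul_smul, ← hs, ← smul_mul_assoc, ← hy, mul_assoc, he.one_sub.eq]
    have hcf : ∀ b, (1 - e) * b = b * (1 - e) := fun b => by
      rw [sub_mul, mul_sub, hcomm, one_mul, mul_one]
    obtain ⟨q, hq⟩ := hreg i
    -- `t i * (1 - e)` is a multiple of `X` times its own image under an operator
    have hzero : t i * (1 - e) = 0 := by
      refine eq_zero_of_eq_X_smul_apply (s • LinearMap.mulRight 𝕜⟦X⟧ q) ?_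
      calc t i * (1 - e) = t i * q * (t i * (1 - e)) := by rw [← mul_assoc, hq]
        _ = (PowerSeries.X * s) • (t i * q * (1 - e)) := by rw [htf, mul_smul_comm]
        _ = (PowerSeries.X * s) • (t i * (1 - e) * q) := by rw [mul_assoc, ← hcf, mul_assoc]
        _ = _ := by rw [mul_smul]; rfl
    rw [mul_sub, mul_one, sub_eq_zero] at hzero
    exact hzero.symm
  have hNe : ∀ n ∈ Ideal.span (Set.range t), n * e = n := by
    intro n hn
    induction hn using Submodule.span_induction with
    | mem x hx => obtain ⟨i, rfl⟩ := hx; exact hte i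
    | zero => exact zero_mul _
    | add x y _ _ hx hy => rw [add_mul, hx, hy]
    | smul c x _ hx => rw [smul_eq_mul, mul_assoc, hx]
  have hlift : ∀ a ∈ Ideal.span (Set.range fun i => ρ (t i)),
      ∃ n ∈ Ideal.span (Set.range t), ρ n = a := by
    intro a ha
    induction ha using Submodule.span_induction with
    | mem x hx => obtain ⟨i, rfl⟩ := hx; exact ⟨t i, Ideal.subset_span ⟨i, rfl⟩, rfl⟩
    | zero => exact ⟨0, zero_mem _, map_zero _⟩
    | add x y _ _ hx hy =>
      obtain ⟨n, hn, rfl⟩ := hx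
      obtain ⟨m, hm, rfl⟩ := hy
      exact ⟨n + m, add_mem hn hm, map_add _ _ _⟩
    | smul c x _ hx =>
      obtain ⟨n, hn, rfl⟩ := hx
      obtain ⟨b, rfl⟩ := hρ.surjective c
      exact ⟨b * n, Ideal.mul_mem_left _ _ hn, hρ.map_mul _ _⟩
  have hle : LinearMap.range (LinearMap.mulRight 𝕜⟦X⟧ e) ≤
      (Ideal.span (Set.range t)).restrictScalars 𝕜⟦X⟧ := by
    refine le_of_forall_eq_add_X_smul ?_
    rintro _ ⟨b, rfl⟩
    obtain ⟨n, hn, hnb⟩ := hlift (ρ (b * e)) (by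
      rw [hρ.map_mul]
      exact Ideal.mul_mem_left _ _ hmem)
    obtain ⟨y, hy⟩ := hρ.exists_sub_eq hnb.symm
    refine ⟨n, hn, y * e, ⟨y, rfl⟩, ?_⟩
    rw [← smul_mul_assoc, ← hy, sub_mul, hNe n hn, mul_assoc, he.eq, LinearMap.mulRight_apply,
      add_sub_cancel]
  refine ⟨e, he, hcomm, hte, hle ⟨1, ?_⟩⟩
  simp

/-- If a central idempotent `e` generates the left ideal generated by elements `t_i`, then its kernel
and its image are the common kernel and the sum of the images of the `t_i`. -/
theorem isCompl_ker_range_of_central_idempotent {R : Type*} [CommRing R] {M : Type*}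
    [AddCommGroup M] [Module R M] {B : Subalgebra R (Module.End R M)} {ι : Type*} {t : ι → B}
    (hB : ∀ b ∈ B, b ∈ Algebra.adjoin R (Set.range fun i => (t i : Module.End R M)))
    {e : B} (he : IsIdempotentElem e) (hcomm : ∀ b, e * b = b * e) (hte : ∀ i, t i * e = t i)
    (hmem : e ∈ Ideal.span (Set.range t)) :
    IsCompl (⨅ i, LinearMap.ker (t i : Module.End R M))
      (⨆ i, LinearMap.range (t i : Module.End R M)) := by
  have hker : (⨅ i, LinearMap.ker (t i : Module.End R M)) = LinearMap.ker (e : Module.End R M) := by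
    refine le_antisymm (fun x hx => ?_) (le_iInf fun i x hx => ?_)
    · rw [Submodule.mem_iInf] at hx
      suffices h : ∀ n ∈ Ideal.span (Set.range t), (n : Module.End R M) x = 0 from h e hmem
      intro n hn
      induction hn using Submodule.span_induction with
      | mem y hy => obtain ⟨i, rfl⟩ := hy; exact hx i
      | zero => rfl
      | add y z _ _ hy hz =>
        rw [Subalgebra.coe_add, LinearMap.add_apply, hy, hz, add_zero]
      | smul c y _ hy =>
        rw [smul_eq_mul, Subalgebra.coe_mul, Module.End.mul_apply, hy, map_zero]
    · rw [LinearMap.mem_ker] at hx ⊢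
      rw [← hte i, Subalgebra.coe_mul, Module.End.mul_apply, hx, map_zero]
  have hran : (⨆ i, LinearMap.range (t i : Module.End R M)) =
      LinearMap.range (e : Module.End R M) := by
    refine le_antisymm (iSup_le fun i => ?_) ?_
    · rintro _ ⟨x, rfl⟩
      rw [← hte i, ← hcomm]
      exact ⟨_, rfl⟩
    · rintro _ ⟨x, rfl⟩
      set J := ⨆ i, LinearMap.range (t i : Module.End R M)
      have ht : ∀ i y, (t i : Module.End R M) y ∈ J := fun i y =>
        Submodule.mem_iSup_of_mem i ⟨y, rfl⟩
      have hstab : ∀ b ∈ Algebra.adjoin R (Set.range fun i => (t i : Module.End R M)),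
          ∀ y ∈ J, b y ∈ J := by
        intro b hb
        induction hb using Algebra.adjoin_induction with
        | mem b hb => obtain ⟨i, rfl⟩ := hb; exact fun y _ => ht i y
        | algebraMap r => exact fun y hy => J.smul_mem r hy
        | add b c _ _ hb hc => exact fun y hy => add_mem (hb y hy) (hc y hy)
        | mul b c _ _ hb hc => exact fun y hy => hb _ (hc y hy)
      suffices h : ∀ n ∈ Ideal.span (Set.range t), (n : Module.End R M) x ∈ J from h e hmem
      intro n hn
      induction hn using Submodule.span_induction with
      | mem y hy => obtain ⟨i, rfl⟩ := hy; exact ht i x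
      | zero => exact zero_mem _
      | add y z _ _ hy hz => exact add_mem hy hz
      | smul c y _ hy => exact hstab c (hB c c.2) _ hy
  rw [hker, hran]
  exact (LinearMap.IsIdempotentElem.isCompl (congrArg Subtype.val he)).symm

end Central

/-! ### The Casimir element of the regular trace form -/

section Casimir

/-- The trace of left multiplication. -/
noncomputable def regTrace (R B : Type*) [CommRing R] [Ring B] [Algebra R B] : B →ₗ[R] R :=
  LinearMap.trace R B ∘ₗ LinearMap.mul R B

theorem regTrace_mul_comm {R B : Type*} [CommRing R] [Ring B] [Algebra R B] (x y : B) :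
    regTrace R B (x * y) = regTrace R B (y * x) := by
  have h : ∀ x y : B, LinearMap.mul R B (x * y) = LinearMap.mul R B x * LinearMap.mul R B y := by
    intro x y
    ext z
    simp [mul_assoc]
  simp only [regTrace, LinearMap.comp_apply, h]
  exact LinearMap.trace_mul_comm _ _ _

theorem regTrace_eq_sum {R B : Type*} [CommRing R] [Ring B] [Algebra R B] {ι : Type*} [Fintype ι]
    (b : Basis ι R B) (x : B) : regTrace R B x = ∑ i, b.repr (x * b i) i := by
  classical
  rw [regTrace, LinearMap.comp_apply, LinearMap.trace_eq_matrix_trace R b]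
  simp [Matrix.trace, LinearMap.toMatrix_apply]

/-- The regular trace form of a semisimple algebra in characteristic zero is nondegenerate: its
radical is generated by an idempotent, the rank of which is a trace. -/
theorem eq_zero_of_regTrace_mul_eq_zero {𝕜 A : Type*} [Field 𝕜] [CharZero 𝕜] [Ring A]
    [Algebra 𝕜 A] [FiniteDimensional 𝕜 A] [IsSemisimpleRing A] {x : A}
    (h : ∀ y, regTrace 𝕜 A (y * x) = 0) : x = 0 := by
  let N : Ideal A :=
    { carrier := {x | ∀ y, regTrace 𝕜 A (y * x) = 0}
      add_mem' := fun ha hb y => by rw [mul_add, map_add, ha, hb, add_zero]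
      zero_mem' := fun y => by rw [mul_zero, map_zero]
      smul_mem' := fun c x hx y => by rw [smul_eq_mul, ← mul_assoc]; exact hx _ }
  obtain ⟨e, he, hI⟩ := IsSemisimpleRing.ideal_eq_span_idempotent N
  have heN : e ∈ N := hI ▸ Ideal.mem_span_singleton_self e
  have h1 : LinearMap.trace 𝕜 A (LinearMap.mul 𝕜 A e) = 0 := by
    have := heN 1
    rwa [one_mul] at this
  have h2 : LinearMap.mul 𝕜 A e = 0 := by
    refine (LinearMap.IsIdempotentElem.trace_eq_zero_iff ?_).mp h1
    ext z
    simp [← mul_assoc, he.eq]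
  have h3 : e = 0 := by
    have := LinearMap.congr_fun h2 1
    simpa using this
  have hx : x ∈ N := h
  rw [hI, h3] at hx
  obtain ⟨a, rfl⟩ := Ideal.mem_span_singleton'.mp hx
  exact mul_zero a

variable {𝕜 : Type*} [Field 𝕜] {A : Type*} [Ring A] [Algebra 𝕜 A] {B : Type*} [Ring B]
  [Algebra 𝕜⟦X⟧ B] {ρ : B →ₛₗ[(constantCoeff : 𝕜⟦X⟧ →+* 𝕜)] A}

/-- If `A` is semisimple, the regular trace form of `B` is unimodular. The conclusion describes a
pair of dual bases `b` and `c`: left multiplication on `b` and right multiplication on `c` have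
the same matrices, and `∑ b_i c_i = 1`. -/
theorem IsAlgReduction.exists_dual_bases [CharZero 𝕜] [IsSemisimpleRing A] [Module.Free 𝕜⟦X⟧ B]
    [Module.Finite 𝕜⟦X⟧ B] (hρ : IsAlgReduction ρ) :
    ∃ (n : ℕ) (b c : Fin n → B) (t : B → Fin n → Fin n → 𝕜⟦X⟧),
      (∀ y i, y * b i = ∑ j, t y i j • b j) ∧ (∀ y j, c j * y = ∑ i, t y i j • c i) ∧
        ∑ i, b i * c i = 1 := by
  let b := Module.finBasis 𝕜⟦X⟧ B
  obtain ⟨a, ha⟩ := hρ.exists_basis b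
  have : FiniteDimensional 𝕜 A := a.finiteDimensional_of_finite
  have htr : ∀ x, regTrace 𝕜 A (ρ x) = constantCoeff (regTrace 𝕜⟦X⟧ B x) := by
    intro x
    rw [regTrace_eq_sum a, regTrace_eq_sum b, map_sum]
    refine Finset.sum_congr rfl fun i _ => ?_
    rw [ha i, ← hρ.map_mul, repr_reduction ha]
  let G : Matrix _ _ 𝕜⟦X⟧ := Matrix.of fun i j => regTrace 𝕜⟦X⟧ B (b i * b j)
  have hdet : IsUnit G.det := by
    rw [PowerSeries.isUnit_iff_constantCoeff, isUnit_iff_ne_zero, RingHom.map_det]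
    intro h0
    obtain ⟨v, hv, hv0⟩ := Matrix.exists_mulVec_eq_zero_iff.mpr h0
    refine hv (funext fun i => ?_)
    have hx : ∑ j, v j • a j = 0 := by
      refine eq_zero_of_regTrace_mul_eq_zero (𝕜 := 𝕜) fun y => ?_
      suffices h : regTrace 𝕜 A ∘ₗ LinearMap.mulRight 𝕜 (∑ j, v j • a j) = 0 from
        LinearMap.congr_fun h y
      refine a.ext fun i => ?_
      have := congrFun hv0 i
      simp only [Matrix.mulVec, dotProduct, RingHom.mapMatrix_apply, Matrix.map_apply, G,
        Matrix.of_apply, ← htr, hρ.map_mul, ← ha, Pi.zero_apply] at this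
      simp only [LinearMap.comp_apply, LinearMap.mulRight_apply, Finset.mul_sum, mul_smul_comm,
        map_sum, map_smul, smul_eq_mul, LinearMap.zero_apply]
      rw [← this]
      exact Finset.sum_congr rfl fun j _ => mul_comm _ _
    exact Fintype.linearIndependent_iff.mp a.linearIndependent v hx i
  let c : Fin _ → B := fun i => ∑ j, G⁻¹ i j • b j
  have hcb : ∀ i l, regTrace 𝕜⟦X⟧ B (c i * b l) = (1 : Matrix _ _ 𝕜⟦X⟧) i l := by
    intro i l
    rw [← Matrix.nonsing_inv_mul G hdet, Matrix.mul_apply]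
    simp only [c, Finset.sum_mul, map_sum, smul_mul_assoc, map_smul, smul_eq_mul]
    rfl
  have hcu : ∀ i u, regTrace 𝕜⟦X⟧ B (c i * u) = b.repr u i := by
    intro i u
    conv_lhs => rw [← b.sum_repr u]
    simp only [Finset.mul_sum, map_sum, mul_smul_comm, map_smul, hcb, Matrix.one_apply, smul_eq_mul]
    simp
  have hexp : ∀ u, u = ∑ j, regTrace 𝕜⟦X⟧ B (c j * u) • b j := by
    intro u
    simp only [hcu, b.sum_repr]
  have hexp' : ∀ u, u = ∑ j, regTrace 𝕜⟦X⟧ B (u * b j) • c j := by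
    intro u
    suffices h : LinearMap.id = ∑ j, (regTrace 𝕜⟦X⟧ B ∘ₗ
        LinearMap.mulRight 𝕜⟦X⟧ (b j)).smulRight (c j) by
      simpa using LinearMap.congr_fun h u
    refine b.ext fun l => ?_
    have h1 : ∀ m, ∑ j, G l j * G⁻¹ j m = (1 : Matrix _ _ 𝕜⟦X⟧) l m := by
      intro m
      rw [← Matrix.mul_nonsing_inv G hdet, Matrix.mul_apply]
    have h2 : ∑ j, G l j • c j = b l := by
      simp only [c, Finset.smul_sum, smul_smul]
      rw [Finset.sum_comm]
      simp only [← Finset.sum_smul, h1, Matrix.one_apply]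
      simp
    simpa [G] using h2.symm
  refine ⟨_, b, c, fun y i j => regTrace 𝕜⟦X⟧ B (c j * (y * b i)), fun y i => hexp _,
    fun y j => ?_, ?_⟩
  · simp only [← mul_assoc]
    exact hexp' (c j * y)
  · have hw : ∀ y, regTrace 𝕜⟦X⟧ B (y * (1 - ∑ i, b i * c i)) = 0 := by
      intro y
      rw [mul_sub, mul_one, map_sub, regTrace_eq_sum b, Finset.mul_sum, map_sum, sub_eq_zero]
      refine Finset.sum_congr rfl fun i _ => ?_
      rw [← hcu, regTrace_mul_comm, mul_assoc]
    have := hexp' (1 - ∑ i, b i * c i)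
    simp only [regTrace_mul_comm _ (b _), hw, zero_smul, Finset.sum_const_zero] at this
    exact (sub_eq_zero.mp this).symm

/-- The operator `x ↦ s x - x s` on `End(M)`. -/
def commutatorMap {R M : Type*} [CommRing R] [AddCommGroup M] [Module R M] (s : Module.End R M) :
    Module.End R (Module.End R M) :=
  LinearMap.mulLeft R s - LinearMap.mulRight R s

theorem commutatorMap_apply {R M : Type*} [CommRing R] [AddCommGroup M] [Module R M]
    (s x : Module.End R M) : commutatorMap s x = s * x - x * s :=
  rfl

/-- Commutators with the elements of an algebra are sums of commutators with its generators. -/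
theorem commutatorMap_mem_iSup_range {R M : Type*} [CommRing R] [AddCommGroup M] [Module R M]
    {ι : Type*} (s : ι → Module.End R M) {y : Module.End R M}
    (hy : y ∈ Algebra.adjoin R (Set.range s)) (x : Module.End R M) :
    commutatorMap y x ∈ ⨆ i, LinearMap.range (commutatorMap (s i)) := by
  induction hy using Algebra.adjoin_induction generalizing x with
  | mem y hy =>
    obtain ⟨i, rfl⟩ := hy
    exact Submodule.mem_iSup_of_mem i ⟨x, rfl⟩
  | algebraMap r =>
    rw [commutatorMap_apply, Algebra.commutes, sub_self]
    exact zero_mem _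
  | add y z _ _ hy hz =>
    have : commutatorMap (y + z) x = commutatorMap y x + commutatorMap z x := by
      simp only [commutatorMap_apply]
      noncomm_ring
    rw [this]
    exact add_mem (hy x) (hz x)
  | mul y z _ _ hy hz =>
    have : commutatorMap (y * z) x = commutatorMap y (z * x) + commutatorMap z (x * y) := by
      simp only [commutatorMap_apply]
      noncomm_ring
    rw [this]
    exact add_mem (hy _) (hz _)

/-- If the algebra `B` generated by operators `s_i` has a semisimple reduction, then the
commutators of `B` with `End(M)` form a saturated submodule: this is the kernel of the map
`x ↦ ∑ c_i x b_i`. -/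
theorem isSaturated_iSup_range_commutatorMap [CharZero 𝕜] [IsSemisimpleRing A] {M : Type*}
    [AddCommGroup M] [Module 𝕜⟦X⟧ M] [Module.Free 𝕜⟦X⟧ M] {ι : Type*}
    (s : ι → Module.End 𝕜⟦X⟧ M)
    [Module.Free 𝕜⟦X⟧ (Algebra.adjoin 𝕜⟦X⟧ (Set.range s))]
    [Module.Finite 𝕜⟦X⟧ (Algebra.adjoin 𝕜⟦X⟧ (Set.range s))]
    {ρ : Algebra.adjoin 𝕜⟦X⟧ (Set.range s) →ₛₗ[(constantCoeff : 𝕜⟦X⟧ →+* 𝕜)] A}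
    (hρ : IsAlgReduction ρ) : IsSaturated (⨆ i, LinearMap.range (commutatorMap (s i))) := by
  obtain ⟨n, b, c, t, hb, hc, hbc⟩ := hρ.exists_dual_bases
  let b' : Fin n → Module.End 𝕜⟦X⟧ M := fun i => b i
  let c' : Fin n → Module.End 𝕜⟦X⟧ M := fun i => c i
  have hb' : ∀ (y : Algebra.adjoin 𝕜⟦X⟧ (Set.range s)) (i : Fin n),
      (y : Module.End 𝕜⟦X⟧ M) * b' i = ∑ j, t y i j • b' j := fun y i => by
    simpa using congrArg Subtype.val (hb y i)
  have hc' : ∀ (y : Algebra.adjoin 𝕜⟦X⟧ (Set.range s)) (j : Fin n),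
      c' j * (y : Module.End 𝕜⟦X⟧ M) = ∑ i, t y i j • c' i := fun y j => by
    simpa using congrArg Subtype.val (hc y j)
  have hbc' : ∑ i, b' i * c' i = 1 := by
    simpa using congrArg Subtype.val hbc
  let P : Module.End 𝕜⟦X⟧ (Module.End 𝕜⟦X⟧ M) :=
    ∑ i, LinearMap.mulRight 𝕜⟦X⟧ (b' i) ∘ₗ LinearMap.mulLeft 𝕜⟦X⟧ (c' i)
  have hP : ∀ x, P x = ∑ i, c' i * x * b' i := fun x => by simp [P]
  have hker : (⨆ i, LinearMap.range (commutatorMap (s i))) = LinearMap.ker P := by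
    refine le_antisymm (iSup_le fun i => ?_) fun x hx => ?_
    · rintro _ ⟨x, rfl⟩
      let y : Algebra.adjoin 𝕜⟦X⟧ (Set.range s) := ⟨s i, Algebra.subset_adjoin ⟨i, rfl⟩⟩
      have h1 : ∑ i, c' i * (y * x) * b' i = ∑ i, ∑ j, t y j i • (c' j * x * b' i) := by
        refine Finset.sum_congr rfl fun i _ => ?_
        rw [← mul_assoc, hc', Finset.sum_mul, Finset.sum_mul]
        simp only [smul_mul_assoc]
      have h2 : ∑ i, c' i * (x * y) * b' i = ∑ i, ∑ j, t y i j • (c' i * x * b' j) := by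
        refine Finset.sum_congr rfl fun i _ => ?_
        rw [← mul_assoc, mul_assoc, hb', Finset.mul_sum]
        simp only [mul_smul_comm]
      rw [LinearMap.mem_ker, commutatorMap_apply, map_sub, hP, hP, sub_eq_zero]
      exact h1.trans (Finset.sum_comm.trans h2.symm)
    · rw [LinearMap.mem_ker, hP] at hx
      -- as `∑ b i * c i = 1`, the element `x` differs from a sum of commutators by `P x`
      have : x = -∑ i, commutatorMap (c' i) (x * b' i) := by
        simp only [commutatorMap_apply, Finset.sum_sub_distrib, ← mul_assoc, hx]
        simp only [mul_assoc, ← Finset.mul_sum, hbc']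
        simp
      rw [this]
      exact neg_mem (Submodule.sum_mem _ fun i _ =>
        commutatorMap_mem_iSup_range s (c i).2 _)
  rw [hker]
  intro r x hr hx
  rw [LinearMap.mem_ker, map_smul] at hx
  ext v
  have hv := LinearMap.congr_fun hx v
  exact (smul_eq_zero.mp hv).resolve_left hr

end Casimir

/-! ### Homogeneous components of quadratic algebras -/

section Components

variable {A : Type*} [CommRing A] {V : Type*} [AddCommGroup V] [Module A V]

open TensorPower (toTensorAlgebra)

theorem twoEquiv_tmul (v w : V) :
    twoEquiv A V (v ⊗ₜ w) = TensorPower.mulEquiv (n := 1) (m := 1)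
      ((PiTensorProduct.tprod A fun _ => v) ⊗ₜ PiTensorProduct.tprod A fun _ => w) := by
  simp only [twoEquiv, LinearEquiv.trans_apply, TensorProduct.congr_tmul]
  congr 2 <;> rw [LinearEquiv.symm_apply_eq] <;> simp

theorem placeEquiv_tmul {a b k : ℕ} (h : a + 2 + b = k) (u : ⨂[A]^a V) (t : V ⊗[A] V)
    (w : ⨂[A]^b V) : placeEquiv A V h ((u ⊗ₜ t) ⊗ₜ w) =
      TensorPower.cast A V h (TensorPower.mulEquiv
        (TensorPower.mulEquiv (u ⊗ₜ twoEquiv A V t) ⊗ₜ w)) :=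
  rfl

theorem toTensorAlgebra_mulEquiv {n m : ℕ} (x : ⨂[A]^n V) (y : ⨂[A]^m V) :
    toTensorAlgebra (TensorPower.mulEquiv (x ⊗ₜ y)) = toTensorAlgebra x * toTensorAlgebra y :=
  TensorPower.toTensorAlgebra_gMul x y

theorem toTensorAlgebra_cast {n m : ℕ} (h : n = m) (x : ⨂[A]^n V) :
    toTensorAlgebra (TensorPower.cast A V h x) = toTensorAlgebra x := by
  subst h
  simp

theorem toTensorAlgebra_twoEquiv (t : V ⊗[A] V) :
    toTensorAlgebra (twoEquiv A V t) = toTensorAlg A V t := by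
  induction t with
  | zero => simp
  | add x y hx hy => simp only [map_add, hx, hy]
  | tmul v w =>
    rw [twoEquiv_tmul]
    refine (toTensorAlgebra_mulEquiv (n := 1) (m := 1) _ _).trans ?_
    simp [toTensorAlg]

theorem toTensorAlgebra_placeEquiv {a b k : ℕ} (h : a + 2 + b = k) (u : ⨂[A]^a V) (t : V ⊗[A] V)
    (w : ⨂[A]^b V) : toTensorAlgebra (placeEquiv A V h ((u ⊗ₜ t) ⊗ₜ w)) =
      toTensorAlgebra u * toTensorAlg A V t * toTensorAlgebra w := by
  rw [placeEquiv_tmul, toTensorAlgebra_cast, toTensorAlgebra_mulEquiv, toTensorAlgebra_mulEquiv,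
    toTensorAlgebra_twoEquiv]

theorem range_mul'_comp_map {T M N : Type*} [Ring T] [Algebra A T] [AddCommGroup M] [Module A M]
    [AddCommGroup N] [Module A N] (f : M →ₗ[A] T) (g : N →ₗ[A] T) :
    LinearMap.range (LinearMap.mul' A T ∘ₗ TensorProduct.map f g) =
      LinearMap.range f * LinearMap.range g := by
  refine le_antisymm ?_ (Submodule.mul_le.mpr ?_)
  · rintro _ ⟨x, rfl⟩
    induction x with
    | zero => simp
    | add x y hx hy => rw [map_add]; exact add_mem hx hy
    | tmul x y => exact Submodule.mul_mem_mul ⟨x, rfl⟩ ⟨y, rfl⟩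
  · rintro _ ⟨x, rfl⟩ _ ⟨y, rfl⟩
    exact ⟨x ⊗ₜ y, rfl⟩

variable (A V) in
theorem range_toTensorAlgebra (n : ℕ) :
    LinearMap.range (toTensorAlgebra : ⨂[A]^n V →ₗ[A] TensorAlgebra A V) =
      LinearMap.range (TensorAlgebra.ι A : V →ₗ[A] TensorAlgebra A V) ^ n := by
  induction n with
  | zero =>
    rw [pow_zero]
    refine le_antisymm ?_ (Submodule.one_le.mpr ⟨PiTensorProduct.tprod A Fin.elim0, by simp⟩)
    rintro _ ⟨x, rfl⟩
    induction x using PiTensorProduct.induction_on with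
    | smul_tprod r f =>
      rw [map_smul]
      exact Submodule.smul_mem _ _ (by simp)
    | add x y hx hy => rw [map_add]; exact add_mem hx hy
  | succ n ih =>
    have h1 : LinearMap.range (toTensorAlgebra : ⨂[A]^1 V →ₗ[A] TensorAlgebra A V) =
        LinearMap.range (TensorAlgebra.ι A : V →ₗ[A] TensorAlgebra A V) := by
      have : (TensorAlgebra.ι A : V →ₗ[A] TensorAlgebra A V) = toTensorAlgebra ∘ₗ
          (PiTensorProduct.subsingletonEquiv (0 : Fin 1)).symm.toLinearMap := by
        ext v
        simp
      rw [this, LinearMap.range_comp_of_range_eq_top _ (LinearEquiv.range _)]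
    have h2 : (toTensorAlgebra : ⨂[A]^(n + 1) V →ₗ[A] TensorAlgebra A V) ∘ₗ
        TensorPower.mulEquiv.toLinearMap =
        LinearMap.mul' A _ ∘ₗ TensorProduct.map toTensorAlgebra toTensorAlgebra :=
      TensorProduct.ext' fun x y => toTensorAlgebra_mulEquiv x y
    rw [pow_succ, ← ih, ← h1, ← range_mul'_comp_map, ← h2,
      LinearMap.range_comp_of_range_eq_top _ (LinearEquiv.range _)]

variable (A V) in
theorem toTensorAlgebra_injective (n : ℕ) :
    Function.Injective (toTensorAlgebra : ⨂[A]^n V →ₗ[A] TensorAlgebra A V) := by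
  intro x y h
  have hx : ∀ z : ⨂[A]^n V, TensorAlgebra.toDirectSum (toTensorAlgebra z) =
      DirectSum.lof A ℕ (fun n => ⨂[A]^n V) n z := by
    intro z
    induction z using PiTensorProduct.induction_on with
    | smul_tprod r f =>
      rw [map_smul, map_smul, map_smul, TensorPower.toTensorAlgebra_tprod,
        TensorAlgebra.toDirectSum_tensorPower_tprod, DirectSum.lof_eq_of]
    | add x y hx hy => simp only [map_add, hx, hy]
  have := (hx x).symm.trans ((congrArg _ h).trans (hx y))
  exact DirectSum.of_injective n this

theorem map_subAt {a b k : ℕ} (h : a + 2 + b = k) (J : Submodule A (V ⊗[A] V)) :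
    (subAt h J).map toTensorAlgebra =
      LinearMap.range (TensorAlgebra.ι A : V →ₗ[A] TensorAlgebra A V) ^ a *
        J.map (toTensorAlg A V) *
        LinearMap.range (TensorAlgebra.ι A : V →ₗ[A] TensorAlgebra A V) ^ b := by
  have hJ : J.map (toTensorAlg A V) = LinearMap.range (toTensorAlg A V ∘ₗ J.subtype) := by
    rw [LinearMap.range_comp, Submodule.range_subtype]
  rw [← range_toTensorAlgebra, ← range_toTensorAlgebra, hJ, ← range_mul'_comp_map,
    ← range_mul'_comp_map, subAt, ← LinearMap.range_comp]
  congr 1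
  refine TensorProduct.ext (TensorProduct.ext ?_)
  ext u j w
  exact toTensorAlgebra_placeEquiv h (PiTensorProduct.tprod A u) (j : V ⊗[A] V)
    (PiTensorProduct.tprod A w)

/-- The two-sided ideal generated by `J`, as a product of submodules of the tensor algebra. -/
theorem mem_quadIdeal_iff (J : Submodule A (V ⊗[A] V)) (x : TensorAlgebra A V) :
    x ∈ quadIdeal J ↔ x ∈ (⊤ : Submodule A (TensorAlgebra A V)) * J.map (toTensorAlg A V) * ⊤ := by
  constructor
  · intro hx
    let K : TwoSidedIdeal (TensorAlgebra A V) := .mk'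
      ((⊤ : Submodule A (TensorAlgebra A V)) * J.map (toTensorAlg A V) * ⊤ : Submodule A _)
      (zero_mem _) (fun h h' => add_mem h h') (fun h => neg_mem h)
      (fun {y z} h => by
        have := Submodule.mul_mem_mul (Submodule.mem_top (R := A) (x := y)) h
        rw [← mul_assoc, ← mul_assoc] at this
        refine (?_ : _ ≤ ⊤ * J.map (toTensorAlg A V) * ⊤) this
        exact mul_le_mul' (mul_le_mul' le_top le_rfl) le_rfl)
      (fun {y z} h => by
        have := Submodule.mul_mem_mul h (Submodule.mem_top (R := A) (x := z))
        rw [mul_assoc] at this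
        refine (?_ : _ ≤ ⊤ * J.map (toTensorAlg A V) * ⊤) this
        exact mul_le_mul' le_rfl le_top)
    have hle : quadIdeal J ≤ K := by
      refine TwoSidedIdeal.span_le.mpr ?_
      rintro _ ⟨j, hj, rfl⟩
      refine (TwoSidedIdeal.mem_mk' _ _ _ _ _ _ _).mpr ?_
      have := Submodule.mul_mem_mul (Submodule.mul_mem_mul (Submodule.mem_top (R := A)
        (x := (1 : TensorAlgebra A V))) (Submodule.mem_map_of_mem (f := toTensorAlg A V) hj))
        (Submodule.mem_top (R := A) (x := (1 : TensorAlgebra A V)))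
      rwa [one_mul, mul_one] at this
    exact (TwoSidedIdeal.mem_mk' _ _ _ _ _ _ _).mp (hle hx)
  · intro hx
    induction hx using Submodule.mul_induction_on' with
    | mem_mul_mem y hy z _ =>
      refine TwoSidedIdeal.mul_mem_right _ _ _ ?_
      induction hy using Submodule.mul_induction_on' with
      | mem_mul_mem c _ j hj =>
        refine TwoSidedIdeal.mul_mem_left _ _ _ ?_
        obtain ⟨j, hj, rfl⟩ := hj
        exact TwoSidedIdeal.subset_span ⟨j, hj, rfl⟩
      | add y _ z _ hy hz => exact add_mem hy hz
    | add y _ z _ hy hz => exact add_mem hy hz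

/-- In degree `k`, the ideal generated by `J` is `J^k`: the homogeneous component of degree `k` is
`V^{⊗k} / J^k`. -/
theorem toTensorAlgebra_mem_quadIdeal_iff (J : Submodule A (V ⊗[A] V)) {k : ℕ} (x : ⨂[A]^k V) :
    toTensorAlgebra x ∈ quadIdeal J ↔ x ∈ sumSub k J := by
  set L := LinearMap.range (TensorAlgebra.ι A : V →ₗ[A] TensorAlgebra A V) with hL
  have hmap : (sumSub k J).map toTensorAlgebra =
      ⨆ (a : ℕ) (b : ℕ) (_ : a + 2 + b = k), L ^ a * J.map (toTensorAlg A V) * L ^ b := by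
    simp only [sumSub, Submodule.map_iSup, map_subAt, hL]
  rw [mem_quadIdeal_iff]
  constructor
  · intro hx
    have htop : (⊤ : Submodule A (TensorAlgebra A V)) = ⨆ n : ℕ, L ^ n :=
      (DirectSum.Decomposition.isInternal (fun n : ℕ => L ^ n)).submodule_iSup_eq_top.symm
    have hx' : toTensorAlgebra x ∈ ⨆ (b : ℕ) (a : ℕ), L ^ a * J.map (toTensorAlg A V) * L ^ b := by
      simpa only [htop, Submodule.iSup_mul, Submodule.mul_iSup] using hx
    have hxk : toTensorAlgebra x ∈ L ^ k := range_toTensorAlgebra A V k ▸ ⟨x, rfl⟩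
    have hdeg : ∀ a b, L ^ a * J.map (toTensorAlg A V) * L ^ b ≤ L ^ (a + 2 + b) := by
      intro a b
      rw [pow_add, pow_add]
      refine mul_le_mul' (mul_le_mul' le_rfl ?_) le_rfl
      rw [← range_toTensorAlgebra]
      rintro _ ⟨t, -, rfl⟩
      exact ⟨twoEquiv A V t, toTensorAlgebra_twoEquiv t⟩
    let p := GradedAlgebra.proj (fun n : ℕ => L ^ n) k
    have hp : p (toTensorAlgebra x) = toTensorAlgebra x := by
      rw [GradedAlgebra.proj_apply, DirectSum.decompose_of_mem_same _ hxk]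
    have hmem : toTensorAlgebra x ∈ (sumSub k J).map toTensorAlgebra := by
      have h1 := Submodule.mem_map_of_mem (f := p) hx'
      rw [hp, Submodule.map_iSup] at h1
      refine (iSup_le fun b => ?_ : _ ≤ (sumSub k J).map toTensorAlgebra) h1
      rw [Submodule.map_iSup]
      refine iSup_le fun a => ?_
      rintro _ ⟨y, hy, rfl⟩
      rw [GradedAlgebra.proj_apply]
      by_cases h : a + 2 + b = k
      · rw [DirectSum.decompose_of_mem_same _ (h ▸ hdeg a b hy), hmap]
        exact Submodule.mem_iSup_of_mem a (Submodule.mem_iSup_of_mem b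
          (Submodule.mem_iSup_of_mem h hy))
      · rw [DirectSum.decompose_of_mem_ne _ (hdeg a b hy) h]
        exact zero_mem _
    obtain ⟨y, hy, hxy⟩ := hmem
    rwa [← toTensorAlgebra_injective A V k hxy]
  · intro hx
    have h1 := Submodule.mem_map_of_mem (f := toTensorAlgebra) hx
    rw [hmap] at h1
    refine (iSup_le fun a => iSup_le fun b => iSup_le fun _ => ?_ :
      _ ≤ (⊤ : Submodule A (TensorAlgebra A V)) * J.map (toTensorAlg A V) * ⊤) h1
    exact mul_le_mul' (mul_le_mul' le_top le_rfl) le_top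

theorem quadComponent_free [IsDomain A] [IsPrincipalIdealRing A] [Module.Finite A V]
    (J : Submodule A (V ⊗[A] V)) (k : ℕ) (hJ : IsSaturated (sumSub k J)) :
    Module.Free A (quadComponent J k) := by
  have hfin : Module.Finite A (quadComponent J k) := by
    rw [Module.Finite.iff_fg]
    refine Submodule.FG.map _ (Submodule.FG.pow ?_ k)
    rw [LinearMap.range_eq_map]
    exact Submodule.FG.map _ Module.Finite.fg_top
  have hmk : ∀ x : TensorAlgebra A V,
      (quadIdeal J).ringCon.mkₐ A x = 0 ↔ x ∈ quadIdeal J := by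
    intro x
    rw [TwoSidedIdeal.mem_iff]
    exact RingCon.eq _
  have htf : Module.IsTorsionFree A (quadComponent J k) := by
    rw [Module.isTorsionFree_iff_smul_eq_zero]
    rintro r ⟨_, y, hy, rfl⟩ h
    rw [← range_toTensorAlgebra] at hy
    obtain ⟨x, rfl⟩ := hy
    refine or_iff_not_imp_left.mpr fun hr => Subtype.ext ?_
    refine (hmk _).mpr ((toTensorAlgebra_mem_quadIdeal_iff J x).mpr (hJ r x hr ?_))
    rw [← toTensorAlgebra_mem_quadIdeal_iff, ← hmk, map_smul, map_smul]
    exact congrArg Subtype.val h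
  infer_instance

end Components

/-! ### Operators in adjacent positions of a tensor power -/

section OpAt

variable {A : Type*} [CommRing A] {V : Type*} [AddCommGroup V] [Module A V]

/-- The positions in `V^{⊗k}` as a single index. -/
theorem iSup_position {α : Type*} [CompleteLattice α] (k : ℕ)
    (f : ∀ {a b : ℕ}, a + 2 + b = k → α) :
    ⨆ (a : ℕ) (b : ℕ) (h : a + 2 + b = k), f h =
      ⨆ p : {p : ℕ × ℕ // p.1 + 2 + p.2 = k}, f p.2 :=
  le_antisymm (iSup_le fun a => iSup_le fun b => iSup_le fun h =>
      le_iSup (fun p : {p : ℕ × ℕ // p.1 + 2 + p.2 = k} => f p.2) ⟨(a, b), h⟩)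
    (iSup_le fun ⟨⟨a, b⟩, h⟩ => le_iSup_of_le a (le_iSup_of_le b (le_iSup_of_le h le_rfl)))

theorem iInf_position {α : Type*} [CompleteLattice α] (k : ℕ)
    (f : ∀ {a b : ℕ}, a + 2 + b = k → α) :
    ⨅ (a : ℕ) (b : ℕ) (h : a + 2 + b = k), f h =
      ⨅ p : {p : ℕ × ℕ // p.1 + 2 + p.2 = k}, f p.2 :=
  iSup_position (α := αᵒᵈ) k f

theorem opAt_placeEquiv {a b k : ℕ} (h : a + 2 + b = k) (S : Module.End A (V ⊗[A] V))
    (z : (⨂[A]^a V ⊗[A] (V ⊗[A] V)) ⊗[A] ⨂[A]^b V) :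
    opAt h S (placeEquiv A V h z) = placeEquiv A V h
      (TensorProduct.map (TensorProduct.map LinearMap.id S) LinearMap.id z) := by
  simp [opAt]

theorem opAt_one {a b k : ℕ} (h : a + 2 + b = k) :
    opAt h (1 : Module.End A (V ⊗[A] V)) = 1 := by
  refine LinearMap.ext fun x => ?_
  obtain ⟨z, rfl⟩ := (placeEquiv A V h).surjective x
  rw [opAt_placeEquiv, Module.End.one_eq_id, TensorProduct.map_id, TensorProduct.map_id]
  rfl

theorem opAt_mul {a b k : ℕ} (h : a + 2 + b = k) (S T : Module.End A (V ⊗[A] V)) :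
    opAt h (S * T) = opAt h S * opAt h T := by
  refine LinearMap.ext fun x => ?_
  obtain ⟨z, rfl⟩ := (placeEquiv A V h).surjective x
  rw [Module.End.mul_apply, opAt_placeEquiv, opAt_placeEquiv, opAt_placeEquiv,
    ← LinearMap.comp_apply, ← TensorProduct.map_comp, ← TensorProduct.map_comp]
  rfl

variable (A V) in
/-- Placing an operator in adjacent positions, as a linear map. -/
noncomputable def opAtLinear {a b k : ℕ} (h : a + 2 + b = k) :
    Module.End A (V ⊗[A] V) →ₗ[A] Module.End A (⨂[A]^k V) where
  toFun := opAt h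
  map_add' S T := by
    rw [opAt, TensorProduct.map_add_right, TensorProduct.map_add_left, LinearMap.add_comp,
      LinearMap.comp_add]
    rfl
  map_smul' r S := by
    rw [opAt, TensorProduct.map_smul_right, TensorProduct.map_smul_left, LinearMap.smul_comp,
      LinearMap.comp_smul]
    rfl

/-- Placing an operator in adjacent positions, as a homomorphism of algebras. -/
noncomputable def opAtHom {a b k : ℕ} (h : a + 2 + b = k) :
    Module.End A (V ⊗[A] V) →ₐ[A] Module.End A (⨂[A]^k V) :=
  AlgHom.ofLinearMap (opAtLinear A V h) (opAt_one h) (opAt_mul h)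

theorem opAtHom_apply {a b k : ℕ} (h : a + 2 + b = k) (S : Module.End A (V ⊗[A] V)) :
    opAtHom h S = opAt h S :=
  rfl

theorem subAt_range {a b k : ℕ} (h : a + 2 + b = k) (T : Module.End A (V ⊗[A] V)) :
    subAt h (LinearMap.range T) = LinearMap.range (opAt h T) := by
  have hT : TensorProduct.map (TensorProduct.map (LinearMap.id : ⨂[A]^a V →ₗ[A] ⨂[A]^a V) T)
      (LinearMap.id : ⨂[A]^b V →ₗ[A] ⨂[A]^b V) =
      TensorProduct.map (TensorProduct.map LinearMap.id (LinearMap.range T).subtype)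
        LinearMap.id ∘ₗ
        TensorProduct.map (TensorProduct.map LinearMap.id T.rangeRestrict) LinearMap.id := by
    rw [← TensorProduct.map_comp, ← TensorProduct.map_comp]
    rfl
  have hs : LinearMap.range (TensorProduct.map
      (TensorProduct.map (LinearMap.id : ⨂[A]^a V →ₗ[A] ⨂[A]^a V) T.rangeRestrict)
      (LinearMap.id : ⨂[A]^b V →ₗ[A] ⨂[A]^b V)) = ⊤ := by
    rw [LinearMap.range_eq_top]
    exact TensorProduct.map_surjective (TensorProduct.map_surjective Function.surjective_id
      T.surjective_rangeRestrict) Function.surjective_id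
  rw [subAt, opAt, hT, ← LinearMap.comp_assoc, LinearMap.range_comp_of_range_eq_top _
    (LinearEquiv.range _), ← LinearMap.comp_assoc, LinearMap.range_comp_of_range_eq_top _ hs]

theorem genAlg_eq_adjoin_range (k : ℕ) (S : Module.End A (V ⊗[A] V)) :
    genAlg k S = Algebra.adjoin A
      (Set.range fun p : {p : ℕ × ℕ // p.1 + 2 + p.2 = k} => opAt p.2 S) := by
  rw [genAlg]
  congr 1
  ext T
  constructor
  · rintro ⟨a, b, h, rfl⟩
    exact ⟨⟨(a, b), h⟩, rfl⟩
  · rintro ⟨⟨⟨a, b⟩, h⟩, rfl⟩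
    exact ⟨a, b, h, rfl⟩

variable (A V) in
/-- The position in the tensor square, as an equivalence `V ⊗ V ≃ V^{⊗2}`. -/
noncomputable def squareEquiv : V ⊗[A] V ≃ₗ[A] ⨂[A]^2 V :=
  ((TensorProduct.rid A (V ⊗[A] V)).symm ≪≫ₗ
    TensorProduct.congr ((TensorProduct.lid A (V ⊗[A] V)).symm ≪≫ₗ
      TensorProduct.congr (PiTensorProduct.isEmptyEquiv (Fin 0)).symm (LinearEquiv.refl A _))
      (PiTensorProduct.isEmptyEquiv (Fin 0)).symm) ≪≫ₗ placeEquiv A V (a := 0) (b := 0) rfl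

theorem opAt_squareEquiv (S : Module.End A (V ⊗[A] V)) (t : V ⊗[A] V) :
    opAt (a := 0) (b := 0) rfl S (squareEquiv A V t) = squareEquiv A V (S t) := by
  simp [squareEquiv, opAt_placeEquiv]

theorem opAtHom_injective :
    Function.Injective (opAtHom (A := A) (V := V) (a := 0) (b := 0) (k := 2) rfl) := by
  intro S T h
  ext1
  ext v w
  have := LinearMap.congr_fun h (squareEquiv A V (v ⊗ₜ w))
  rw [opAtHom_apply, opAtHom_apply, opAt_squareEquiv, opAt_squareEquiv] at this
  exact (squareEquiv A V).injective this

theorem genAlg_two (S : Module.End A (V ⊗[A] V)) :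
    genAlg 2 S = (Algebra.adjoin A {S}).map (opAtHom (a := 0) (b := 0) (k := 2) rfl) := by
  rw [AlgHom.map_adjoin_singleton, genAlg]
  congr 1
  ext T
  constructor
  · rintro ⟨a, b, h, rfl⟩
    obtain rfl : a = 0 := by omega
    obtain rfl : b = 0 := by omega
    rfl
  · rintro rfl
    exact ⟨0, 0, rfl, rfl⟩

theorem opAt_mem_genAlg {a b k : ℕ} (h : a + 2 + b = k) {S T : Module.End A (V ⊗[A] V)}
    (hT : T ∈ Algebra.adjoin A {S}) : opAt h T ∈ genAlg k S := by
  have h1 : opAtHom h T ∈ (Algebra.adjoin A {S}).map (opAtHom h) := ⟨T, hT, rfl⟩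
  rw [AlgHom.map_adjoin_singleton] at h1
  refine Algebra.adjoin_mono ?_ h1
  rintro _ rfl
  exact ⟨a, b, h, rfl⟩

end OpAt

section Deformation

variable {𝕜 : Type*} [Field 𝕜]
  {E : Type*} [AddCommGroup E] [Module 𝕜 E] {Eh : Type*} [AddCommGroup Eh] [Module 𝕜⟦X⟧ Eh]
  [Module.Free 𝕜⟦X⟧ Eh] [Module.Finite 𝕜⟦X⟧ Eh]
  {π : Eh →ₛₗ[(constantCoeff : 𝕜⟦X⟧ →+* 𝕜)] E}

/-- The `k`-th tensor power of a reduction. -/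
noncomputable def IsReduction.tensorPower (hπ : IsReduction π) (k : ℕ) :
    (⨂[𝕜⟦X⟧]^k Eh) →ₛₗ[(constantCoeff : 𝕜⟦X⟧ →+* 𝕜)] ⨂[𝕜]^k E :=
  (hπ.exists_tensorPower k).choose

theorem IsReduction.tensorPower_isReduction (hπ : IsReduction π) (k : ℕ) :
    IsReduction (hπ.tensorPower k) :=
  (hπ.exists_tensorPower k).choose_spec.1

theorem IsReduction.tensorPower_tprod (hπ : IsReduction π) {k : ℕ} (x : Fin k → Eh) :
    hπ.tensorPower k (PiTensorProduct.tprod 𝕜⟦X⟧ x) = PiTensorProduct.tprod 𝕜 fun i => π (x i) :=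
  (hπ.exists_tensorPower k).choose_spec.2 x

theorem IsReduction.tensorPower_mulEquiv (hπ : IsReduction π) {n m : ℕ} (x : ⨂[𝕜⟦X⟧]^n Eh)
    (y : ⨂[𝕜⟦X⟧]^m Eh) : hπ.tensorPower (n + m) (TensorPower.mulEquiv (x ⊗ₜ y)) =
      TensorPower.mulEquiv (hπ.tensorPower n x ⊗ₜ hπ.tensorPower m y) := by
  induction x using PiTensorProduct.induction_on with
  | add x y hx hy => simp only [TensorProduct.add_tmul, map_add, hx, hy]
  | smul_tprod r f =>
    induction y using PiTensorProduct.induction_on with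
    | add x y hx hy => simp only [TensorProduct.tmul_add, map_add, hx, hy]
    | smul_tprod s g =>
      simp only [LinearMap.map_smulₛₗ, ← TensorProduct.smul_tmul', TensorProduct.tmul_smul, map_smul,
        hπ.tensorPower_tprod]
      rw [← TensorPower.gMul_def, ← TensorPower.gMul_def, TensorPower.tprod_mul_tprod,
        TensorPower.tprod_mul_tprod, hπ.tensorPower_tprod]
      congr 3
      ext i
      refine Fin.addCases (fun i => ?_) (fun i => ?_) i <;> simp

theorem IsReduction.tensorPower_cast (hπ : IsReduction π) {n m : ℕ} (h : n = m)
    (x : ⨂[𝕜⟦X⟧]^n Eh) : hπ.tensorPower m (TensorPower.cast 𝕜⟦X⟧ Eh h x) =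
      TensorPower.cast 𝕜 E h (hπ.tensorPower n x) := by
  subst h
  simp

theorem IsReduction.tensorPower_twoEquiv (hπ : IsReduction π) (t : Eh ⊗[𝕜⟦X⟧] Eh) :
    hπ.tensorPower 2 (twoEquiv 𝕜⟦X⟧ Eh t) = twoEquiv 𝕜 E (TensorProduct.map π π t) := by
  induction t with
  | zero => simp
  | add x y hx hy => simp only [map_add, hx, hy]
  | tmul v w =>
    rw [TensorProduct.map_tmul, twoEquiv_tmul, twoEquiv_tmul]
    refine (hπ.tensorPower_mulEquiv (n := 1) (m := 1) _ _).trans ?_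
    rw [hπ.tensorPower_tprod, hπ.tensorPower_tprod]

theorem IsReduction.tensorPower_placeEquiv (hπ : IsReduction π) {a b k : ℕ} (h : a + 2 + b = k)
    (u : ⨂[𝕜⟦X⟧]^a Eh) (t : Eh ⊗[𝕜⟦X⟧] Eh) (w : ⨂[𝕜⟦X⟧]^b Eh) :
    hπ.tensorPower k (placeEquiv 𝕜⟦X⟧ Eh h ((u ⊗ₜ t) ⊗ₜ w)) =
      placeEquiv 𝕜 E h ((hπ.tensorPower a u ⊗ₜ TensorProduct.map π π t) ⊗ₜ
        hπ.tensorPower b w) := by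
  rw [placeEquiv_tmul, placeEquiv_tmul, hπ.tensorPower_cast, hπ.tensorPower_mulEquiv,
    hπ.tensorPower_mulEquiv, hπ.tensorPower_twoEquiv]

theorem IsReduction.isOperatorDeformation_opAt (hπ : IsReduction π)
    {Sh : Module.End 𝕜⟦X⟧ (Eh ⊗[𝕜⟦X⟧] Eh)} {S : Module.End 𝕜 (E ⊗[𝕜] E)}
    (hS : IsOperatorDeformation (TensorProduct.map π π) Sh S) {a b k : ℕ} (h : a + 2 + b = k) :
    IsOperatorDeformation (hπ.tensorPower k) (opAt h Sh) (opAt h S) := by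
  intro x
  obtain ⟨z, rfl⟩ := (placeEquiv 𝕜⟦X⟧ Eh h).surjective x
  induction z with
  | zero => simp
  | add x y hx hy => simp only [map_add, hx, hy]
  | tmul y w =>
    induction y with
    | zero => simp
    | add x y hx hy => simp only [TensorProduct.add_tmul, map_add, hx, hy]
    | tmul u t =>
      rw [opAt_placeEquiv, TensorProduct.map_tmul, TensorProduct.map_tmul,
        hπ.tensorPower_placeEquiv, hπ.tensorPower_placeEquiv, opAt_placeEquiv,
        TensorProduct.map_tmul, TensorProduct.map_tmul, hS]
      rfl

end Deformation

/-! ### Spectral decompositions -/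

section Spectral

variable {R : Type*} [CommRing R] {M : Type*} [AddCommGroup M] [Module R M]

/-- The operators `p_i` are polynomials in `S`, they form a complete system of orthogonal
idempotents, and `S` acts by the scalar `ev_i` on the image of `p_i`. -/
structure IsSpectralDecomposition {n : ℕ} (S : Module.End R M) (ev : Fin n → R)
    (p : Fin n → Module.End R M) : Prop extends CompleteOrthogonalIdempotents p where
  mem : ∀ i, p i ∈ Algebra.adjoin R {S}
  mul_eq : ∀ i, S * p i = ev i • p i

namespace IsSpectralDecomposition

variable {n : ℕ} {S : Module.End R M} {ev : Fin n → R} {p : Fin n → Module.End R M}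

theorem mul_eq' (h : IsSpectralDecomposition S ev p) (i : Fin n) : p i * S = ev i • p i := by
  rw [← h.mul_eq]
  exact (Algebra.commute_of_mem_adjoin_singleton_of_commute (h.mem i) (Commute.refl S)).symm.eq

/-- The projection `p_i` annihilates the eigenvectors for eigenvalues other than `ev_i`. -/
theorem smul_apply_eq (h : IsSpectralDecomposition S ev p) (i : Fin n) {μ : R} {x : M}
    (hx : S x = μ • x) : (ev i - μ) • p i x = 0 := by
  have := LinearMap.congr_fun (h.mul_eq' i) x
  rw [Module.End.mul_apply, hx, map_smul, LinearMap.smul_apply] at this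
  rw [sub_smul, this, sub_self]

theorem sum_apply (h : IsSpectralDecomposition S ev p) (x : M) : ∑ i, p i x = x := by
  rw [← LinearMap.sum_apply, h.complete, Module.End.one_apply]

theorem range_le_eigenspace (h : IsSpectralDecomposition S ev p) (i : Fin n) :
    LinearMap.range (p i) ≤ S.eigenspace (ev i) := by
  rintro _ ⟨x, rfl⟩
  rw [Module.End.mem_eigenspace_iff]
  exact LinearMap.congr_fun (h.mul_eq i) x

theorem apply_eq_self (h : IsSpectralDecomposition S ev p) {i : Fin n} {μ : R}
    (hμ : ∀ j, j ≠ i → IsUnit (ev j - μ)) {x : M} (hx : S x = μ • x) : p i x = x := by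
  have h1 : ∑ j, p j x = p i x := Finset.sum_eq_single i
    (fun j _ hj => (hμ j hj).smul_eq_zero.mp (h.smul_apply_eq j hx))
    fun hi => absurd (Finset.mem_univ i) hi
  rw [← h1, h.sum_apply]

theorem eigenspace_eq (h : IsSpectralDecomposition S ev p)
    (hev : ∀ i j, i ≠ j → IsUnit (ev i - ev j)) (i : Fin n) :
    S.eigenspace (ev i) = LinearMap.range (p i) := by
  refine le_antisymm (fun x hx => ⟨x, ?_⟩) (h.range_le_eigenspace i)
  exact h.apply_eq_self (fun j hj => hev j i hj) (Module.End.mem_eigenspace_iff.mp hx)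

theorem iSup_range_ne (h : IsSpectralDecomposition S ev p) (m : Fin n) :
    ⨆ (i) (_ : i ≠ m), LinearMap.range (p i) = LinearMap.range (1 - p m) := by
  refine le_antisymm (iSup₂_le fun i hi => ?_) ?_
  · rintro _ ⟨x, rfl⟩
    refine ⟨p i x, ?_⟩
    have h0 : p m (p i x) = 0 := LinearMap.congr_fun (h.ortho hi.symm) x
    rw [LinearMap.sub_apply, h0, sub_zero, Module.End.one_apply]
  · rintro _ ⟨x, rfl⟩
    have : (1 - p m) x = ∑ i ∈ Finset.univ.erase m, p i x := by
      rw [LinearMap.sub_apply, Module.End.one_apply, sub_eq_iff_eq_add,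
        Finset.sum_erase_add _ _ (Finset.mem_univ m), h.sum_apply]
    rw [this]
    exact Submodule.sum_mem _ fun i hi => Submodule.mem_iSup_of_mem i
      (Submodule.mem_iSup_of_mem (Finset.ne_of_mem_erase hi) ⟨x, rfl⟩)

theorem isCompl_range (h : IsSpectralDecomposition S ev p) (m : Fin n) :
    IsCompl (LinearMap.range (p m)) (⨆ (i) (_ : i ≠ m), LinearMap.range (p i)) := by
  rw [h.iSup_range_ne, ← LinearMap.IsIdempotentElem.ker_eq_range_one_sub (h.idem m)]
  exact LinearMap.IsIdempotentElem.isCompl (h.idem m)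

theorem isInternal (h : IsSpectralDecomposition S ev p) :
    DirectSum.IsInternal fun i => LinearMap.range (p i) := by
  refine DirectSum.isInternal_submodule_of_iSupIndep_of_iSup_eq_top
    (fun i => (h.isCompl_range i).disjoint) (eq_top_iff.mpr fun x _ => ?_)
  rw [← h.sum_apply x]
  exact Submodule.sum_mem _ fun i _ => Submodule.mem_iSup_of_mem i ⟨x, rfl⟩

/-- The inverse of `S - ev_m` on the complement of the eigenspace for `ev_m`, extended by zero. -/
theorem exists_partial_inverse (h : IsSpectralDecomposition S ev p)
    (hev : ∀ i j, i ≠ j → IsUnit (ev i - ev j)) (m : Fin n) :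
    ∃ Q ∈ Algebra.adjoin R {S}, Q * (S - ev m • 1) = 1 - p m ∧ (S - ev m • 1) * Q = 1 - p m := by
  let Q := ∑ i ∈ Finset.univ.erase m, Ring.inverse (ev i - ev m) • p i
  have hsum : 1 - p m = ∑ i ∈ Finset.univ.erase m, p i := by
    rw [sub_eq_iff_eq_add, Finset.sum_erase_add _ _ (Finset.mem_univ m), h.complete]
  refine ⟨Q, Subalgebra.sum_mem _ fun i _ => Subalgebra.smul_mem _ (h.mem i) _, ?_, ?_⟩
  · rw [hsum, Finset.sum_mul]
    refine Finset.sum_congr rfl fun i hi => ?_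
    rw [smul_mul_assoc, mul_sub, h.mul_eq', mul_smul_comm, mul_one, ← sub_smul, smul_smul,
      Ring.inverse_mul_cancel _ (hev i m (Finset.ne_of_mem_erase hi)), one_smul]
  · rw [hsum, Finset.mul_sum]
    refine Finset.sum_congr rfl fun i hi => ?_
    rw [mul_smul_comm, sub_mul, h.mul_eq, smul_mul_assoc, one_mul, ← sub_smul, smul_smul,
      Ring.inverse_mul_cancel _ (hev i m (Finset.ne_of_mem_erase hi)), one_smul]

theorem sub_mul_eq_zero (h : IsSpectralDecomposition S ev p) (m : Fin n) :
    (S - ev m • 1) * p m = 0 := by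
  rw [sub_mul, h.mul_eq, smul_mul_assoc, one_mul, sub_self]

theorem mul_sub_eq_zero (h : IsSpectralDecomposition S ev p) (m : Fin n) :
    p m * (S - ev m • 1) = 0 := by
  rw [mul_sub, h.mul_eq', mul_smul_comm, mul_one, sub_self]

theorem iSup_eq_range_sub (h : IsSpectralDecomposition S ev p)
    (hev : ∀ i j, i ≠ j → IsUnit (ev i - ev j)) (m : Fin n) :
    ⨆ (i) (_ : i ≠ m), LinearMap.range (p i) = LinearMap.range (S - ev m • 1) := by
  obtain ⟨Q, -, hQ, hQ'⟩ := h.exists_partial_inverse hev m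
  rw [h.iSup_range_ne]
  refine le_antisymm ?_ ?_
  · rw [← hQ']
    exact LinearMap.range_comp_le_range _ _
  · have : S - ev m • 1 = (1 - p m) * (S - ev m • 1) := by
      rw [sub_mul, h.mul_sub_eq_zero, one_mul, sub_zero]
    rw [this]
    exact LinearMap.range_comp_le_range _ _

theorem exists_mul_eq_smul (h : IsSpectralDecomposition S ev p) (i : Fin n) {a : Module.End R M}
    (ha : a ∈ Algebra.adjoin R {S}) : ∃ c : R, a * p i = c • p i := by
  induction ha using Algebra.adjoin_induction with
  | mem a ha =>
    obtain rfl := ha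
    exact ⟨ev i, h.mul_eq i⟩
  | algebraMap r => exact ⟨r, (Algebra.smul_def _ _).symm⟩
  | add a b _ _ ha hb =>
    obtain ⟨c, hc⟩ := ha
    obtain ⟨d, hd⟩ := hb
    exact ⟨c + d, by rw [add_mul, hc, hd, add_smul]⟩
  | mul a b _ _ ha hb =>
    obtain ⟨c, hc⟩ := ha
    obtain ⟨d, hd⟩ := hb
    exact ⟨d * c, by rw [mul_assoc, hd, mul_smul_comm, hc, smul_smul]⟩

end IsSpectralDecomposition

end Spectral

section Existence

theorem eq_zero_of_isNilpotent_of_commute {A : Type*} [Ring A] [IsSemisimpleRing A] {x : A}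
    (hx : IsNilpotent x) (hcomm : ∀ y, Commute x y) : x = 0 := by
  obtain ⟨k, hk⟩ := hx
  induction k with
  | zero => rw [pow_zero] at hk; rw [← mul_one x, hk, mul_zero]
  | succ k ih =>
    cases k with
    | zero => simpa using hk
    | succ k =>
      refine ih (eq_zero_of_forall_mul_mul_eq_zero fun y => ?_)
      rw [((hcomm y).pow_left (k + 1)).eq, mul_assoc, ← pow_add,
        show k + 1 + (k + 1) = k + 1 + 1 + k by ring, pow_add, hk, zero_mul, mul_zero]

variable {𝕜 : Type*} [Field 𝕜] {M : Type*} [AddCommGroup M] [Module 𝕜 M]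

open Polynomial in
/-- An operator with split characteristic polynomial which generates a semisimple algebra is
diagonalizable. -/
theorem aeval_nodal_eq_zero [FiniteDimensional 𝕜 M] {n : ℕ} {S : Module.End 𝕜 M} {ev : Fin n → 𝕜}
    (hev : ∀ μ : 𝕜, S.HasEigenvalue μ ↔ ∃ i, ev i = μ) (hsplits : S.charpoly.Splits)
    [IsSemisimpleRing (Algebra.adjoin 𝕜 {S})] :
    aeval S (Lagrange.nodal Finset.univ ev) = 0 := by
  let x : Algebra.adjoin 𝕜 {S} :=
    ⟨aeval S (Lagrange.nodal Finset.univ ev), aeval_mem_adjoin_singleton 𝕜 S⟩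
  have hroots := hsplits.eq_prod_roots_of_monic S.charpoly_monic
  have hdvd : (S.charpoly.roots.map fun a => X - C a).prod ∣
      Lagrange.nodal Finset.univ ev ^ Multiset.card S.charpoly.roots := by
    rw [← Multiset.prod_replicate, ← Multiset.map_const']
    refine Multiset.prod_dvd_prod_of_dvd _ _ fun μ hμ => ?_
    obtain ⟨i, rfl⟩ := (hev μ).mp
      ((Module.End.hasEigenvalue_iff_isRoot_charpoly S μ).mpr (isRoot_of_mem_roots hμ))
    exact Lagrange.X_sub_C_dvd_nodal ev (Finset.mem_univ i)
  have hnil : IsNilpotent x := by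
    refine ⟨Multiset.card S.charpoly.roots, Subtype.ext ?_⟩
    change aeval S (Lagrange.nodal Finset.univ ev) ^ _ = 0
    rw [← map_pow]
    obtain ⟨q, hq⟩ := hdvd
    rw [hq, ← hroots, map_mul, LinearMap.aeval_self_charpoly, zero_mul]
  exact congrArg Subtype.val (eq_zero_of_isNilpotent_of_commute hnil fun y => mul_comm' x y)

open Polynomial in
theorem exists_spectralDecomposition {n : ℕ} {S : Module.End 𝕜 M} {ev : Fin n → 𝕜}
    (hinj : Function.Injective ev) (hS : aeval S (Lagrange.nodal Finset.univ ev) = 0) :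
    ∃ p, IsSpectralDecomposition S ev p := by
  let p : Fin n → Module.End 𝕜 M := fun i => aeval S (Lagrange.basis Finset.univ ev i)
  have hsum : ∑ i, p i = 1 := by
    cases n with
    | zero =>
      have h0 : (1 : Module.End 𝕜 M) = 0 := by simpa using hS
      rw [h0]
      simp
    | succ n =>
      have := congrArg (aeval S) (Lagrange.sum_basis (s := Finset.univ) hinj.injOn ⟨0, by simp⟩)
      simpa using this
  have hmul : ∀ i, S * p i = ev i • p i := by
    intro i
    have h1 : (X - C (ev i)) * Lagrange.basis Finset.univ ev i =
        C (Lagrange.nodalWeight Finset.univ ev i) * Lagrange.nodal Finset.univ ev := by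
      rw [Lagrange.basis_eq_prod_sub_inv_mul_nodal_div (Finset.mem_univ i), mul_left_comm,
        EuclideanDomain.mul_div_cancel' (X_sub_C_ne_zero _)
          (Lagrange.X_sub_C_dvd_nodal ev (Finset.mem_univ i))]
    have h2 := congrArg (aeval S) h1
    rw [map_mul, map_mul, hS, mul_zero, map_sub, aeval_X, aeval_C, sub_mul, sub_eq_zero] at h2
    rw [h2, Algebra.smul_def]
  have hcomm : ∀ i, p i * S = ev i • p i := by
    intro i
    rw [← hmul]
    exact (Algebra.commute_of_mem_adjoin_singleton_of_commute
      (aeval_mem_adjoin_singleton 𝕜 S) (Commute.refl S)).symm.eq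
  have hortho : Pairwise (p · * p · = 0) := by
    intro i j hij
    have h1 : (ev i - ev j) • (p i * p j) = 0 := by
      rw [sub_smul, ← smul_mul_assoc, ← hcomm, mul_assoc, hmul, mul_smul_comm, sub_self]
    exact (smul_eq_zero.mp h1).resolve_left (sub_ne_zero.mpr (hinj.ne hij))
  refine ⟨p, (CompleteOrthogonalIdempotents.iff_ortho_complete.mpr ⟨hortho, hsum⟩), fun i =>
    aeval_mem_adjoin_singleton 𝕜 S, hmul⟩

end Existence

section Lift

theorem subalgebra_finite {R B : Type*} [CommRing R] [IsNoetherianRing R] [Ring B] [Algebra R B]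
    [Module.Finite R B] (C : Subalgebra R B) : Module.Finite R C :=
  inferInstanceAs (Module.Finite R (Subalgebra.toSubmodule C))

theorem subalgebra_free {R B : Type*} [CommRing R] [IsDomain R] [IsPrincipalIdealRing R] [Ring B]
    [Algebra R B] [Module.Finite R B] [Module.Free R B] (C : Subalgebra R B) : Module.Free R C :=
  inferInstanceAs (Module.Free R (Subalgebra.toSubmodule C))

variable {𝕜 : Type*} [Field 𝕜]
  {E : Type*} [AddCommGroup E] [Module 𝕜 E] {Eh : Type*} [AddCommGroup Eh] [Module 𝕜⟦X⟧ Eh]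
  {π : Eh →ₛₗ[(constantCoeff : 𝕜⟦X⟧ →+* 𝕜)] E}

/-- Spectral decompositions lift along deformations that generate saturated algebras. -/
theorem exists_spectralDecomposition_lift [Module.Free 𝕜⟦X⟧ Eh] [Module.Finite 𝕜⟦X⟧ Eh]
    (hπ : IsReduction π) {Sh : Module.End 𝕜⟦X⟧ Eh} {S : Module.End 𝕜 E}
    (hS : IsOperatorDeformation π Sh S)
    (hsat : IsSaturated (Subalgebra.toSubmodule (Algebra.adjoin 𝕜⟦X⟧ {Sh})))
    {n : ℕ} {ev : Fin n → 𝕜} {p : Fin n → Module.End 𝕜 E} (hp : IsSpectralDecomposition S ev p)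
    (hne : ∀ i, p i ≠ 0) :
    ∃ (evh : Fin n → 𝕜⟦X⟧) (e : Fin n → Module.End 𝕜⟦X⟧ Eh), IsSpectralDecomposition Sh evh e ∧
      (∀ i, constantCoeff (evh i) = ev i) ∧ ∀ i, IsOperatorDeformation π (e i) (p i) := by
  have hrh : Set.range (fun _ : Unit => Sh) = {Sh} := Set.range_const
  have hr : Set.range (fun _ : Unit => S) = {S} := Set.range_const
  rw [← hrh] at hsat
  obtain ⟨ρ, hρ, hρd⟩ := exists_adjoin_reduction hπ (fun _ : Unit => hS) hsat
  have hmem : ∀ i, p i ∈ Algebra.adjoin 𝕜 (Set.range fun _ : Unit => S) := fun i => by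
    rw [hr]
    exact hp.mem i
  let f : Fin n → Algebra.adjoin 𝕜 (Set.range fun _ : Unit => S) := fun i => ⟨p i, hmem i⟩
  have := subalgebra_finite (Algebra.adjoin 𝕜⟦X⟧ (Set.range fun _ : Unit => Sh))
  have := subalgebra_free (Algebra.adjoin 𝕜⟦X⟧ (Set.range fun _ : Unit => Sh))
  choose e he hef using fun i => hρ.exists_idempotent_lift (f := f i) (Subtype.ext (hp.idem i))
  have hcomm : ∀ x y : Algebra.adjoin 𝕜⟦X⟧ (Set.range fun _ : Unit => Sh), Commute x y := by
    intro x y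
    have : IsMulCommutative (Algebra.adjoin 𝕜⟦X⟧ (Set.range fun _ : Unit => Sh)) :=
      Algebra.isMulCommutative_adjoin _ (by rintro _ ⟨_, rfl⟩ _ ⟨_, rfl⟩; rfl)
    exact mul_comm' x y
  have hortho : Pairwise (e · * e · = 0) := by
    intro i j hij
    refine hρ.eq_zero_of_idempotent ((he i).mul_of_commute (hcomm _ _) (he j)) ?_
    rw [hρ.map_mul, hef, hef]
    exact Subtype.ext (hp.ortho hij)
  have ho : OrthogonalIdempotents e := ⟨he, hortho⟩
  have hsum : ∑ i, e i = 1 := by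
    have h1 := hρ.eq_zero_of_idempotent (ho.isIdempotentElem_sum (s := Finset.univ)).one_sub (by
      rw [map_sub, hρ.map_one, map_sum, sub_eq_zero]
      simp only [hef]
      refine Subtype.ext ?_
      rw [AddSubmonoidClass.coe_finsetSum]
      exact hp.complete.symm)
    exact (sub_eq_zero.mp h1).symm
  let s : Algebra.adjoin 𝕜⟦X⟧ (Set.range fun _ : Unit => Sh) :=
    ⟨Sh, Algebra.subset_adjoin ⟨(), rfl⟩⟩
  choose evh hevh using fun i => hρ.exists_mul_eq_smul (he i) (fun a => by
    obtain ⟨c, hc⟩ := hp.exists_mul_eq_smul i (a := a) (by rw [← hr]; exact a.2)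
    exact ⟨c, by rw [hef]; exact Subtype.ext hc⟩) s
  have hd : ∀ i, IsOperatorDeformation π (e i : Module.End 𝕜⟦X⟧ Eh) (p i) := fun i => by
    have := hρd (e i)
    rwa [hef] at this
  refine ⟨evh, fun i => e i, ⟨⟨⟨fun i => congrArg Subtype.val (he i), fun i j hij =>
    congrArg Subtype.val (hortho hij)⟩, ?_⟩, fun i => ?_, fun i => congrArg Subtype.val (hevh i)⟩,
    fun i => ?_, hd⟩
  · have := congrArg Subtype.val hsum
    rwa [AddSubmonoidClass.coe_finsetSum] at this
  · rw [← hrh]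
    exact (e i).2
  · obtain ⟨v, hv⟩ : ∃ v, p i v ≠ 0 := by
      by_contra! h
      exact hne i (LinearMap.ext h)
    obtain ⟨x, rfl⟩ := hπ.surjective v
    have h1 : π (Sh ((e i : Module.End 𝕜⟦X⟧ Eh) x)) =
        π (evh i • (e i : Module.End 𝕜⟦X⟧ Eh) x) :=
      congrArg π (LinearMap.congr_fun (congrArg Subtype.val (hevh i)) x)
    rw [hS, hd, LinearMap.map_smulₛₗ, hd, ← Module.End.mul_apply, hp.mul_eq,
      LinearMap.smul_apply] at h1
    exact (smul_left_injective 𝕜 hv h1).symm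

end Lift

/-! ### The relations of the quantum semigroup -/

section Triple

variable {A : Type*} [CommRing A] {V : Type*} [AddCommGroup V] [Module A V]

/-- The operator `U ⊗ T ⊗ W` on `V^{⊗a} ⊗ V^{⊗2} ⊗ V^{⊗b} = V^{⊗k}`. -/
noncomputable def opTriple {a b k : ℕ} (h : a + 2 + b = k) (U : Module.End A (⨂[A]^a V))
    (T : Module.End A (V ⊗[A] V)) (W : Module.End A (⨂[A]^b V)) : Module.End A (⨂[A]^k V) :=
  (placeEquiv A V h).toLinearMap ∘ₗ TensorProduct.map (TensorProduct.map U T) W ∘ₗ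
    (placeEquiv A V h).symm.toLinearMap

theorem opTriple_placeEquiv {a b k : ℕ} (h : a + 2 + b = k) (U : Module.End A (⨂[A]^a V))
    (T : Module.End A (V ⊗[A] V)) (W : Module.End A (⨂[A]^b V))
    (z : (⨂[A]^a V ⊗[A] (V ⊗[A] V)) ⊗[A] ⨂[A]^b V) :
    opTriple h U T W (placeEquiv A V h z) =
      placeEquiv A V h (TensorProduct.map (TensorProduct.map U T) W z) := by
  simp [opTriple]

theorem opTriple_mul {a b k : ℕ} (h : a + 2 + b = k) (U U' : Module.End A (⨂[A]^a V))
    (T T' : Module.End A (V ⊗[A] V)) (W W' : Module.End A (⨂[A]^b V)) :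
    opTriple h U T W * opTriple h U' T' W' = opTriple h (U * U') (T * T') (W * W') := by
  refine LinearMap.ext fun x => ?_
  obtain ⟨z, rfl⟩ := (placeEquiv A V h).surjective x
  rw [Module.End.mul_apply, opTriple_placeEquiv, opTriple_placeEquiv, opTriple_placeEquiv,
    ← LinearMap.comp_apply, ← TensorProduct.map_comp, ← TensorProduct.map_comp]
  rfl

theorem opTriple_sub {a b k : ℕ} (h : a + 2 + b = k) (U : Module.End A (⨂[A]^a V))
    (T T' : Module.End A (V ⊗[A] V)) (W : Module.End A (⨂[A]^b V)) :
    opTriple h U (T - T') W = opTriple h U T W - opTriple h U T' W := by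
  rw [eq_sub_iff_add_eq]
  refine LinearMap.ext fun x => ?_
  obtain ⟨z, rfl⟩ := (placeEquiv A V h).surjective x
  rw [LinearMap.add_apply, opTriple_placeEquiv, opTriple_placeEquiv, opTriple_placeEquiv,
    ← map_add, ← LinearMap.add_apply, ← TensorProduct.map_add_left, ← TensorProduct.map_add_right,
    sub_add_cancel]

theorem commutatorMap_opAt_opTriple {a b k : ℕ} (h : a + 2 + b = k) (S T : Module.End A (V ⊗[A] V))
    (U : Module.End A (⨂[A]^a V)) (W : Module.End A (⨂[A]^b V)) :
    commutatorMap (opAt h S) (opTriple h U T W) = opTriple h U (commutatorMap S T) W := by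
  have hS : opAt h S = opTriple h 1 S 1 := rfl
  rw [commutatorMap_apply, commutatorMap_apply, hS, opTriple_mul, opTriple_mul, opTriple_sub,
    one_mul, one_mul, mul_one, mul_one]

theorem piTensorHomMap_mulEquiv {n m : ℕ} (f : ⨂[A]^n (Module.End A V))
    (g : ⨂[A]^m (Module.End A V)) (x : ⨂[A]^n V) (y : ⨂[A]^m V) :
    PiTensorProduct.piTensorHomMap (TensorPower.mulEquiv (f ⊗ₜ g))
        (TensorPower.mulEquiv (x ⊗ₜ y)) =
      TensorPower.mulEquiv (PiTensorProduct.piTensorHomMap f x ⊗ₜ[A]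
        PiTensorProduct.piTensorHomMap g y) := by
  induction f using PiTensorProduct.induction_on with
  | add f f' hf hf' => simp only [TensorProduct.add_tmul, map_add, LinearMap.add_apply, hf, hf']
  | smul_tprod r f =>
  induction g using PiTensorProduct.induction_on with
  | add f f' hf hf' => simp only [TensorProduct.tmul_add, map_add, LinearMap.add_apply, hf, hf']
  | smul_tprod s g =>
  induction x using PiTensorProduct.induction_on with
  | add f f' hf hf' => simp only [TensorProduct.add_tmul, map_add, hf, hf']
  | smul_tprod r' x =>
  induction y using PiTensorProduct.induction_on with
  | add f f' hf hf' => simp only [TensorProduct.tmul_add, map_add, hf, hf']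
  | smul_tprod s' y =>
    have key : ∀ i, Fin.append f g i (Fin.append x y i) =
        Fin.append (fun i => f i (x i)) (fun i => g i (y i)) i := fun i => by
      refine Fin.addCases (fun i => ?_) (fun i => ?_) i <;> simp
    simp only [← TensorProduct.smul_tmul', TensorProduct.tmul_smul, map_smul, LinearMap.smul_apply]
    rw [← TensorPower.gMul_def, ← TensorPower.gMul_def, TensorPower.tprod_mul_tprod,
      TensorPower.tprod_mul_tprod, PiTensorProduct.piTensorHomMap_tprod_tprod,
      PiTensorProduct.piTensorHomMap_tprod_tprod, PiTensorProduct.piTensorHomMap_tprod_tprod,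
      ← TensorPower.gMul_def, TensorPower.tprod_mul_tprod]
    simp only [key]
    rw [smul_comm r' s]

theorem piTensorHomMap_cast {n m : ℕ} (h : n = m) (f : ⨂[A]^n (Module.End A V)) (x : ⨂[A]^n V) :
    PiTensorProduct.piTensorHomMap (TensorPower.cast A _ h f) (TensorPower.cast A V h x) =
      TensorPower.cast A V h (PiTensorProduct.piTensorHomMap f x) := by
  subst h
  simp

theorem piTensorHomMap_twoEquiv (t : Module.End A V ⊗[A] Module.End A V) (s : V ⊗[A] V) :
    PiTensorProduct.piTensorHomMap (twoEquiv A _ t) (twoEquiv A V s) =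
      twoEquiv A V (TensorProduct.homTensorHomMap (.id A) V V V V t s) := by
  induction t with
  | zero => simp
  | add x y hx hy => simp only [map_add, LinearMap.add_apply, hx, hy]
  | tmul f g =>
    induction s with
    | zero => simp
    | add x y hx hy => simp only [map_add, hx, hy]
    | tmul v w =>
      rw [twoEquiv_tmul, twoEquiv_tmul]
      refine (piTensorHomMap_mulEquiv (n := 1) (m := 1) _ _ _ _).trans ?_
      rw [PiTensorProduct.piTensorHomMap_tprod_tprod, PiTensorProduct.piTensorHomMap_tprod_tprod,
        TensorProduct.homTensorHomMap_apply, TensorProduct.map_tmul, twoEquiv_tmul]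

theorem piTensorHomMap_placeEquiv {a b k : ℕ} (h : a + 2 + b = k) (u : ⨂[A]^a (Module.End A V))
    (t : Module.End A V ⊗[A] Module.End A V) (w : ⨂[A]^b (Module.End A V)) :
    PiTensorProduct.piTensorHomMap (placeEquiv A _ h ((u ⊗ₜ t) ⊗ₜ w)) =
      opTriple h (PiTensorProduct.piTensorHomMap u)
        (TensorProduct.homTensorHomMap (.id A) V V V V t) (PiTensorProduct.piTensorHomMap w) := by
  refine LinearMap.ext fun x => ?_
  obtain ⟨z, rfl⟩ := (placeEquiv A V h).surjective x
  induction z with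
  | zero => simp
  | add x y hx hy => simp only [map_add, hx, hy]
  | tmul y w =>
    induction y with
    | zero => simp
    | add x y hx hy => simp only [TensorProduct.add_tmul, map_add, hx, hy]
    | tmul u t =>
      rw [opTriple_placeEquiv, TensorProduct.map_tmul, TensorProduct.map_tmul, placeEquiv_tmul,
        placeEquiv_tmul, placeEquiv_tmul, piTensorHomMap_cast, piTensorHomMap_mulEquiv,
        piTensorHomMap_mulEquiv, piTensorHomMap_twoEquiv]

variable [Module.Free A V] [Module.Finite A V]

variable (A V) in
theorem piTensorHomMap_bijective (k : ℕ) : Function.Bijective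
    (PiTensorProduct.piTensorHomMap : (⨂[A]^k (Module.End A V)) →ₗ[A] Module.End A (⨂[A]^k V)) := by
  classical
  let b := Module.Free.chooseBasis A V
  let Bh := Basis.piTensorProduct fun _ : Fin k => b.end
  let B := (Basis.piTensorProduct fun _ : Fin k => b).end.reindex
    (Equiv.arrowProdEquivProdArrow (Fin k) (fun _ => Module.Free.ChooseBasisIndex A V)
      (fun _ => Module.Free.ChooseBasisIndex A V)).symm
  have h : (PiTensorProduct.piTensorHomMap :
      (⨂[A]^k (Module.End A V)) →ₗ[A] Module.End A (⨂[A]^k V)) =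
      (Bh.equiv B (Equiv.refl _)).toLinearMap := by
    refine Bh.ext fun p => (Basis.piTensorProduct fun _ : Fin k => b).ext fun q => ?_
    rw [LinearEquiv.coe_coe, Basis.equiv_apply, Basis.reindex_apply, Basis.end_apply_apply,
      Basis.piTensorProduct_apply, Basis.piTensorProduct_apply,
      PiTensorProduct.piTensorHomMap_tprod_tprod]
    simp only [Basis.end_apply_apply]
    split_ifs with hq
    · rw [Basis.piTensorProduct_apply]
      congr 1
      ext i
      exact (if_pos (congrFun hq i)).trans rfl
    · obtain ⟨i, hi⟩ : ∃ i, (p i).2 ≠ q i := by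
        by_contra! hc
        exact hq (funext hc)
      exact (PiTensorProduct.tprod A).map_coord_zero i (if_neg hi)
  rw [h]
  exact LinearEquiv.bijective _

theorem map_piTensorHomMap_subAt {a b k : ℕ} (h : a + 2 + b = k)
    {J : Submodule A (Module.End A V ⊗[A] Module.End A V)} {S : Module.End A (V ⊗[A] V)}
    (hJ : J.map (TensorProduct.homTensorHomMap (.id A) V V V V) =
      LinearMap.range (commutatorMap S)) :
    (subAt h J).map PiTensorProduct.piTensorHomMap =
      LinearMap.range (commutatorMap (opAt h S)) := by
  refine le_antisymm ?_ ?_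
  · rintro _ ⟨_, ⟨z, rfl⟩, rfl⟩
    induction z with
    | zero => simp
    | add x y hx hy => simp only [map_add]; exact add_mem hx hy
    | tmul y w =>
      induction y with
      | zero => simp
      | add x y hx hy => simp only [TensorProduct.add_tmul, map_add]; exact add_mem hx hy
      | tmul u j =>
        obtain ⟨T, hT⟩ : TensorProduct.homTensorHomMap (.id A) V V V V j ∈
            LinearMap.range (commutatorMap S) := hJ ▸ ⟨j, j.2, rfl⟩
        rw [LinearMap.comp_apply, TensorProduct.map_tmul, TensorProduct.map_tmul,
          LinearEquiv.coe_coe, piTensorHomMap_placeEquiv, Submodule.subtype_apply, ← hT,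
          ← commutatorMap_opAt_opTriple]
        exact ⟨_, rfl⟩
  · rintro _ ⟨y, rfl⟩
    obtain ⟨x, rfl⟩ := (piTensorHomMap_bijective A V k).2 y
    obtain ⟨z, rfl⟩ := (placeEquiv A (Module.End A V) h).surjective x
    induction z with
    | zero => simp
    | add x y hx hy => simp only [map_add]; exact add_mem hx hy
    | tmul y w =>
      induction y with
      | zero => simp
      | add x y hx hy => simp only [TensorProduct.add_tmul, map_add]; exact add_mem hx hy
      | tmul u t =>
        obtain ⟨j, hj, hjt⟩ : commutatorMap S (TensorProduct.homTensorHomMap (.id A) V V V V t) ∈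
            J.map (TensorProduct.homTensorHomMap (.id A) V V V V) := hJ ▸ ⟨_, rfl⟩
        rw [piTensorHomMap_placeEquiv, commutatorMap_opAt_opTriple, ← hjt,
          ← piTensorHomMap_placeEquiv]
        exact ⟨_, ⟨(u ⊗ₜ ⟨j, hj⟩) ⊗ₜ w, rfl⟩, rfl⟩

/-- If the relations `J` correspond to the commutators with `S`, then the homogeneous relations
of degree `k` correspond to the commutators with the operators generating `A_k(S)`. -/
theorem map_piTensorHomMap_sumSub (k : ℕ)
    {J : Submodule A (Module.End A V ⊗[A] Module.End A V)} {S : Module.End A (V ⊗[A] V)}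
    (hJ : J.map (TensorProduct.homTensorHomMap (.id A) V V V V) =
      LinearMap.range (commutatorMap S)) :
    (sumSub k J).map PiTensorProduct.piTensorHomMap =
      ⨆ p : {p : ℕ × ℕ // p.1 + 2 + p.2 = k}, LinearMap.range (commutatorMap (opAt p.2 S)) := by
  simp only [sumSub, Submodule.map_iSup, map_piTensorHomMap_subAt _ hJ]
  exact iSup_position k fun {_ _} h => LinearMap.range (commutatorMap (opAt h S))

end Triple

section Relations

variable {A : Type*} [CommRing A] {V : Type*} [AddCommGroup V] [Module A V]

theorem homTensorHomMap_sigma23 (v : V ⊗[A] V) (ψ : Module.Dual A V ⊗[A] Module.Dual A V) :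
    TensorProduct.homTensorHomMap (.id A) V V V V (sigma23 A V (v ⊗ₜ ψ)) =
      (TensorProduct.dualDistrib A V V ψ).smulRight v := by
  induction v with
  | zero => simp
  | add x y hx hy =>
    rw [TensorProduct.add_tmul, map_add, map_add, hx, hy]
    ext
    simp
  | tmul v w =>
    induction ψ with
    | zero => ext; simp
    | add x y hx hy =>
      rw [TensorProduct.tmul_add, map_add, map_add, hx, hy]
      ext
      simp [add_smul]
    | tmul f g =>
      ext x y
      simp [sigma23, toEnd, ← TensorProduct.smul_tmul', smul_smul, mul_comm]

variable [Module.Free A V] [Module.Finite A V]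

variable (A V) in
theorem dualDistrib_surjective : Function.Surjective (TensorProduct.dualDistrib A V V) :=
  (TensorProduct.dualDistribEquiv A V V).surjective

/-- Under the identification `End(V) ⊗ End(V) = End(V ⊗ V)`, the relations of the quantum
semigroup defined by the eigenspaces of `S` are the commutators with `S`. -/
theorem map_semigroupRel {n : ℕ} {S : Module.End A (V ⊗[A] V)} {ev : Fin n → A}
    {p : Fin n → Module.End A (V ⊗[A] V)} (h : IsSpectralDecomposition S ev p)
    (hev : ∀ i j, i ≠ j → IsUnit (ev i - ev j)) :
    (semigroupRel fun i => LinearMap.range (p i)).map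
      (TensorProduct.homTensorHomMap (.id A) V V V V) = LinearMap.range (commutatorMap S) := by
  have hcomm : ∀ (φ : Module.Dual A (V ⊗[A] V)) (i : Fin n) (v : V ⊗[A] V),
      commutatorMap S (φ.smulRight (p i v)) = -(φ ∘ₗ (S - ev i • 1)).smulRight (p i v) := by
    intro φ i v
    refine LinearMap.ext fun x => ?_
    have hS : S (p i v) = ev i • p i v := LinearMap.congr_fun (h.mul_eq i) v
    simp only [commutatorMap_apply, LinearMap.sub_apply, Module.End.mul_apply,
      LinearMap.smulRight_apply, map_smul, hS, LinearMap.neg_apply, LinearMap.comp_apply, map_sub,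
      LinearMap.smul_apply, Module.End.one_apply, smul_eq_mul, sub_smul, mul_smul]
    rw [smul_comm]
    abel
  rw [semigroupRel, Submodule.map_iSup, Submodule.map_iSup]
  refine le_antisymm (iSup_le fun i => ?_) ?_
  · rintro _ ⟨_, ⟨_, ⟨z, rfl⟩, rfl⟩, rfl⟩
    induction z with
    | zero => simp
    | add x y hx hy => simp only [map_add]; exact add_mem hx hy
    | tmul v ψ =>
      obtain ⟨_, v, rfl⟩ := v
      obtain ⟨ψ, hψ⟩ := ψ
      obtain ⟨Q, -, hQ, -⟩ := h.exists_partial_inverse hev i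
      rw [TensorProduct.map_tmul, Submodule.subtype_apply, Submodule.subtype_apply,
        homTensorHomMap_sigma23]
      set φ := TensorProduct.dualDistrib A V V ψ
      have hφ : ∀ x, φ (p i x) = 0 := fun x =>
        (Submodule.mem_dualAnnihilator _).mp hψ _ ⟨x, rfl⟩
      refine ⟨-(φ ∘ₗ Q).smulRight (p i v), ?_⟩
      rw [map_neg, hcomm, neg_neg, LinearMap.comp_assoc, ← Module.End.mul_eq_comp, hQ]
      refine LinearMap.ext fun x => ?_
      simp [hφ]
  · rintro _ ⟨y, rfl⟩
    let B := Module.Free.chooseBasis A (V ⊗[A] V)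
    -- it is enough to treat the operators of rank one with values in an eigenspace
    have hy : y = ∑ j, ∑ i, (B.coord j).smulRight (p i (y (B j))) := by
      have hp : ∀ j, ∑ i, (B.coord j).smulRight (p i (y (B j))) =
          (B.coord j).smulRight (y (B j)) := by
        intro j
        refine LinearMap.ext fun x => ?_
        simp only [LinearMap.sum_apply, LinearMap.smulRight_apply, ← Finset.smul_sum, h.sum_apply]
      simp only [hp]
      refine LinearMap.ext fun x => ?_
      conv_lhs => rw [← B.sum_repr x, map_sum]
      simp only [map_smul, LinearMap.sum_apply, LinearMap.smulRight_apply, Basis.coord_apply]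
    rw [hy, map_sum]
    refine Submodule.sum_mem _ fun j _ => ?_
    rw [map_sum]
    refine Submodule.sum_mem _ fun i _ => Submodule.mem_iSup_of_mem i ?_
    rw [hcomm]
    refine neg_mem ?_
    obtain ⟨ψ, hψ⟩ := dualDistrib_surjective A V (B.coord j ∘ₗ (S - ev i • 1))
    have hmem : ψ ∈ perp (LinearMap.range (p i)) := by
      rw [perp, Submodule.mem_comap, Submodule.mem_dualAnnihilator, hψ]
      rintro _ ⟨x, rfl⟩
      have : (S - ev i • 1) (p i x) = 0 := LinearMap.congr_fun (h.sub_mul_eq_zero i) x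
      rw [LinearMap.comp_apply, this, map_zero]
    rw [← hψ, ← homTensorHomMap_sigma23]
    exact ⟨_, ⟨_, ⟨⟨p i (y (B j)), _, rfl⟩ ⊗ₜ ⟨ψ, hmem⟩, rfl⟩, rfl⟩, rfl⟩

end Relations

/-! ### Well situated pairs -/

section WellSituated

variable {A : Type*} [CommRing A] {V : Type*} [AddCommGroup V] [Module A V]

theorem subAt_range_eq_ker {n : ℕ} {S : Module.End A (V ⊗[A] V)} {ev : Fin n → A}
    {p : Fin n → Module.End A (V ⊗[A] V)} (h : IsSpectralDecomposition S ev p)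
    (hev : ∀ i j, i ≠ j → IsUnit (ev i - ev j)) (m : Fin n) {a b k : ℕ} (hk : a + 2 + b = k) :
    subAt hk (LinearMap.range (p m)) = LinearMap.ker (opAt hk (S - ev m • 1)) := by
  obtain ⟨Q, -, hQ, -⟩ := h.exists_partial_inverse hev m
  rw [subAt_range]
  refine le_antisymm ?_ fun x hx => ⟨x, ?_⟩
  · rintro _ ⟨x, rfl⟩
    rw [LinearMap.mem_ker, ← Module.End.mul_apply, ← opAt_mul, h.sub_mul_eq_zero,
      ← opAtHom_apply, map_zero, LinearMap.zero_apply]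
  · have h1 : p m = 1 - Q * (S - ev m • 1) := by rw [hQ, sub_sub_cancel]
    rw [h1, ← opAtHom_apply, map_sub, map_one, map_mul, LinearMap.sub_apply, Module.End.mul_apply,
      opAtHom_apply _ (S - _), LinearMap.mem_ker.mp hx, map_zero, sub_zero, Module.End.one_apply]

theorem tensorPower_free [Module.Free A V] [Module.Finite A V] (k : ℕ) :
    Module.Free A (⨂[A]^k V) := by
  classical
  exact Module.Free.of_basis
    (Basis.piTensorProduct fun _ : Fin k => Module.Free.chooseBasis A V)

theorem tensorPower_finite [Module.Free A V] [Module.Finite A V] (k : ℕ) :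
    Module.Finite A (⨂[A]^k V) := by
  classical
  exact Module.Finite.of_basis
    (Basis.piTensorProduct fun _ : Fin k => Module.Free.chooseBasis A V)

theorem sumSub_eq_bot {k : ℕ} (hk : k < 2) (J : Submodule A (V ⊗[A] V)) : sumSub k J = ⊥ := by
  simp only [sumSub, iSup_eq_bot]
  intro a b h
  omega

variable {𝕜 : Type*} [Field 𝕜]
  {E : Type*} [AddCommGroup E] [Module 𝕜 E] {Eh : Type*} [AddCommGroup Eh] [Module 𝕜⟦X⟧ Eh]
  [Module.Free 𝕜⟦X⟧ Eh] [Module.Finite 𝕜⟦X⟧ Eh]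
  {π : Eh →ₛₗ[(constantCoeff : 𝕜⟦X⟧ →+* 𝕜)] E}

/-- Let `s_i` be operators that generate an algebra `B` with semisimple reduction. If the operators
`t_i = s_i - c` are von Neumann regular in `B`, then the left ideal that they generate is
generated by a central idempotent, so that their common kernel is complemented by the sum of their
images. -/
theorem IsReduction.isCompl_iInf_ker_iSup_range (hπ : IsReduction π) {ι : Type*}
    {sh : ι → Module.End 𝕜⟦X⟧ Eh} {s : ι → Module.End 𝕜 E}
    (hd : ∀ i, IsOperatorDeformation π (sh i) (s i))
    (hss : IsSemisimpleRing (Algebra.adjoin 𝕜 (Set.range s)))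
    (hsat : IsSaturated (Subalgebra.toSubmodule (Algebra.adjoin 𝕜⟦X⟧ (Set.range sh))))
    (c : 𝕜⟦X⟧) (hreg : ∀ i, ∃ q ∈ Algebra.adjoin 𝕜⟦X⟧ (Set.range sh),
      (sh i - c • 1) * q * (sh i - c • 1) = sh i - c • 1) :
    IsCompl (⨅ i, LinearMap.ker (sh i - c • 1)) (⨆ i, LinearMap.range (sh i - c • 1)) := by
  obtain ⟨ρ, hρ, hρd⟩ := exists_adjoin_reduction hπ hd hsat
  have := subalgebra_finite (Algebra.adjoin 𝕜⟦X⟧ (Set.range sh))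
  have := subalgebra_free (Algebra.adjoin 𝕜⟦X⟧ (Set.range sh))
  let σ : ι → Algebra.adjoin 𝕜⟦X⟧ (Set.range sh) := fun i =>
    ⟨sh i, Algebra.subset_adjoin ⟨i, rfl⟩⟩
  let t : ι → Algebra.adjoin 𝕜⟦X⟧ (Set.range sh) := fun i => σ i - c • 1
  have hρσ : ∀ i, (ρ (σ i) : Module.End 𝕜 E) = s i := fun i => by
    refine LinearMap.ext fun v => ?_
    obtain ⟨x, rfl⟩ := hπ.surjective v
    rw [← hρd]
    exact hd i x
  obtain ⟨e, he, hcomm, hte, hmem⟩ := hρ.exists_central_idempotent t (by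
    rw [eq_top_iff, ← Algebra.adjoin_adjoin_coe_preimage]
    refine Algebra.adjoin_le ?_
    rintro x ⟨i, hi⟩
    have hx : x = ρ (t i) + constantCoeff c • 1 := by
      rw [map_sub, LinearMap.map_smulₛₗ, hρ.map_one, sub_add_cancel]
      exact Subtype.ext ((hρσ i).trans hi).symm
    rw [hx]
    exact add_mem (Algebra.subset_adjoin ⟨i, rfl⟩) (Subalgebra.smul_mem _ (one_mem _) _))
    fun i => by
      obtain ⟨q, hq, h⟩ := hreg i
      exact ⟨⟨q, hq⟩, Subtype.ext h⟩
  refine isCompl_ker_range_of_central_idempotent (t := t) (fun b hb => ?_) he hcomm hte hmem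
  refine Algebra.adjoin_le ?_ hb
  rintro _ ⟨i, rfl⟩
  rw [← sub_add_cancel (sh i) (c • 1)]
  exact add_mem (Algebra.subset_adjoin ⟨i, rfl⟩) (Subalgebra.smul_mem _ (one_mem _) _)

theorem IsReduction.isCompl_interSub_sumSub (hπ : IsReduction π)
    {Sh : Module.End 𝕜⟦X⟧ (Eh ⊗[𝕜⟦X⟧] Eh)} {S : Module.End 𝕜 (E ⊗[𝕜] E)}
    (hS : IsOperatorDeformation (TensorProduct.map π π) Sh S) {n : ℕ} {ev : Fin n → 𝕜⟦X⟧}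
    {p : Fin n → Module.End 𝕜⟦X⟧ (Eh ⊗[𝕜⟦X⟧] Eh)} (h : IsSpectralDecomposition Sh ev p)
    (hev : ∀ i j, i ≠ j → IsUnit (ev i - ev j)) {k : ℕ} (hss : IsSemisimpleRing (genAlg k S))
    (hsat : IsSaturated (M := Module.End 𝕜⟦X⟧ (⨂[𝕜⟦X⟧]^k Eh))
      (Subalgebra.toSubmodule (genAlg k Sh))) (m : Fin n) :
    IsCompl (interSub k (LinearMap.range (p m)))
      (sumSub k (⨆ (i) (_ : i ≠ m), LinearMap.range (p i))) := by
  obtain ⟨Q, hQmem, -, hQ⟩ := h.exists_partial_inverse hev m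
  have hQmem' : ∀ i : {p : ℕ × ℕ // p.1 + 2 + p.2 = k}, opAt i.2 Q ∈ genAlg k Sh := fun i =>
    opAt_mem_genAlg i.2 hQmem
  have := tensorPower_free (A := 𝕜⟦X⟧) (V := Eh) k
  have := tensorPower_finite (A := 𝕜⟦X⟧) (V := Eh) k
  rw [genAlg_eq_adjoin_range] at hss hsat hQmem'
  have hopAt : ∀ i : {p : ℕ × ℕ // p.1 + 2 + p.2 = k},
      opAt i.2 Sh - ev m • 1 = opAt i.2 (Sh - ev m • 1) := fun i => by
    rw [← opAtHom_apply i.2 (Sh - _), map_sub, map_smul, map_one, opAtHom_apply]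
  have hcompl := (hπ.tensorPower_isReduction k).isCompl_iInf_ker_iSup_range
    (fun i : {p : ℕ × ℕ // p.1 + 2 + p.2 = k} => hπ.isOperatorDeformation_opAt hS i.2) hss hsat
    (ev m) fun i => ⟨opAt i.2 Q, hQmem' i, by
      refine (congrArg (fun T => T * opAt i.2 Q * T) (hopAt i)).trans
        (Eq.trans ?_ (hopAt i).symm)
      rw [← opAt_mul, ← opAt_mul, hQ, sub_mul, one_mul, h.mul_sub_eq_zero, sub_zero]⟩
  rw [interSub, sumSub, iInf_position k (fun {_ _} h => subAt h (LinearMap.range (p m))),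
    iSup_position k (fun {_ _} h => subAt h (⨆ (i) (_ : i ≠ m), LinearMap.range (p i))),
    h.iSup_eq_range_sub hev]
  simp only [subAt_range_eq_ker h hev, subAt_range, ← hopAt]
  exact hcompl

end WellSituated

/-! ### Saturation of the relations of the quantum semigroup -/

section Semigroup

theorem IsSaturated.isSplitting {R : Type*} [CommRing R] [IsDomain R] [IsPrincipalIdealRing R]
    {M : Type*} [AddCommGroup M] [Module R M] [Module.Finite R M] {N : Submodule R M}
    (h : IsSaturated N) : IsSplitting N := by
  have htf : Module.IsTorsionFree R (M ⧸ N) := by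
    rw [Module.isTorsionFree_iff_smul_eq_zero]
    intro r x hx
    obtain ⟨x, rfl⟩ := N.mkQ_surjective x
    refine or_iff_not_imp_left.mpr fun hr => ?_
    rw [← map_smul, Submodule.mkQ_apply, Submodule.Quotient.mk_eq_zero] at hx
    rw [Submodule.mkQ_apply, Submodule.Quotient.mk_eq_zero]
    exact h r x hr hx
  obtain ⟨g, hg⟩ := N.mkQ.exists_rightInverse_of_surjective N.range_mkQ
  have hid : IsIdempotentElem (g ∘ₗ N.mkQ : Module.End R M) := by
    change (g ∘ₗ N.mkQ) ∘ₗ (g ∘ₗ N.mkQ) = _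
    rw [LinearMap.comp_assoc, ← LinearMap.comp_assoc N.mkQ, hg, LinearMap.id_comp]
  have hker : LinearMap.ker (g ∘ₗ N.mkQ) = N := by
    rw [LinearMap.ker_comp_of_ker_eq_bot, Submodule.ker_mkQ]
    exact LinearMap.ker_eq_bot_of_inverse hg
  have := (LinearMap.IsIdempotentElem.isCompl hid).symm
  rw [hker] at this
  exact ⟨_, this⟩

theorem IsSaturated.of_map {R : Type*} [CommRing R] {M M' : Type*} [AddCommGroup M] [Module R M]
    [AddCommGroup M'] [Module R M'] {f : M →ₗ[R] M'} (hf : Function.Injective f)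
    {N : Submodule R M} (h : IsSaturated (N.map f)) : IsSaturated N := by
  intro r x hr hx
  obtain ⟨y, hy, hyx⟩ := h r (f x) hr ⟨r • x, hx, map_smul f r x⟩
  rwa [← hf hyx]

variable {𝕜 : Type*} [Field 𝕜] [CharZero 𝕜]
  {E : Type*} [AddCommGroup E] [Module 𝕜 E] {Eh : Type*} [AddCommGroup Eh] [Module 𝕜⟦X⟧ Eh]
  [Module.Free 𝕜⟦X⟧ Eh] [Module.Finite 𝕜⟦X⟧ Eh]
  {π : Eh →ₛₗ[(constantCoeff : 𝕜⟦X⟧ →+* 𝕜)] E}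

/-- Commutators with deformed operators form a saturated submodule, as soon as the algebra that
these operators generate is saturated and has a semisimple reduction. -/
theorem IsReduction.isSaturated_commutators (hπ : IsReduction π) {ι : Type*}
    {sh : ι → Module.End 𝕜⟦X⟧ Eh} {s : ι → Module.End 𝕜 E}
    (hs : ∀ i, IsOperatorDeformation π (sh i) (s i))
    (hss : IsSemisimpleRing (Algebra.adjoin 𝕜 (Set.range s)))
    (hsat : IsSaturated (Subalgebra.toSubmodule (Algebra.adjoin 𝕜⟦X⟧ (Set.range sh)))) :
    IsSaturated (⨆ i, LinearMap.range (commutatorMap (sh i))) := by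
  obtain ⟨ρ, hρ, -⟩ := exists_adjoin_reduction hπ hs hsat
  have := subalgebra_finite (Algebra.adjoin 𝕜⟦X⟧ (Set.range sh))
  have := subalgebra_free (Algebra.adjoin 𝕜⟦X⟧ (Set.range sh))
  exact isSaturated_iSup_range_commutatorMap sh hρ

theorem IsReduction.isSaturated_sumSub (hπ : IsReduction π)
    {Sh : Module.End 𝕜⟦X⟧ (Eh ⊗[𝕜⟦X⟧] Eh)} {S : Module.End 𝕜 (E ⊗[𝕜] E)}
    (hS : IsOperatorDeformation (TensorProduct.map π π) Sh S)
    {J : Submodule 𝕜⟦X⟧ (Module.End 𝕜⟦X⟧ Eh ⊗[𝕜⟦X⟧] Module.End 𝕜⟦X⟧ Eh)}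
    (hJ : J.map (TensorProduct.homTensorHomMap (.id 𝕜⟦X⟧) Eh Eh Eh Eh) =
      LinearMap.range (commutatorMap Sh)) {k : ℕ} (hss : IsSemisimpleRing (genAlg k S))
    (hsat : IsSaturated (M := Module.End 𝕜⟦X⟧ (⨂[𝕜⟦X⟧]^k Eh))
      (Subalgebra.toSubmodule (genAlg k Sh))) : IsSaturated (sumSub k J) := by
  have := tensorPower_free (A := 𝕜⟦X⟧) (V := Eh) k
  have := tensorPower_finite (A := 𝕜⟦X⟧) (V := Eh) k
  rw [genAlg_eq_adjoin_range] at hss hsat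
  refine IsSaturated.of_map (M' := Module.End 𝕜⟦X⟧ (⨂[𝕜⟦X⟧]^k Eh))
    (piTensorHomMap_bijective 𝕜⟦X⟧ Eh k).1 ?_
  rw [map_piTensorHomMap_sumSub k hJ]
  exact (hπ.tensorPower_isReduction k).isSaturated_commutators
    (fun i => hπ.isOperatorDeformation_opAt hS i.2) hss hsat

end Semigroup

/-! ### Deformations of quadratic algebras -/

section QuadraticDeformations

variable {𝕜 : Type*} [Field 𝕜]
  {E : Type*} [AddCommGroup E] [Module 𝕜 E] {Eh : Type*} [AddCommGroup Eh] [Module 𝕜⟦X⟧ Eh]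
  {π : Eh →ₛₗ[(constantCoeff : 𝕜⟦X⟧ →+* 𝕜)] E}

theorem map_range_of_isOperatorDeformation (hπ : Function.Surjective π)
    {φ : Module.End 𝕜⟦X⟧ Eh} {ψ : Module.End 𝕜 E} (h : IsOperatorDeformation π φ ψ) :
    (LinearMap.range φ).map π = LinearMap.range ψ := by
  ext y
  constructor
  · rintro ⟨_, ⟨x, rfl⟩, rfl⟩
    exact ⟨π x, (h x).symm⟩
  · rintro ⟨v, rfl⟩
    obtain ⟨x, rfl⟩ := hπ v
    exact ⟨φ x, ⟨x, rfl⟩, h x⟩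

/-- A quadratic algebra is a flat deformation as soon as the submodules `J^k` are saturated. -/
theorem IsReduction.isFlatDeformation [Module.Free 𝕜⟦X⟧ Eh] [Module.Finite 𝕜⟦X⟧ Eh]
    (hπ : IsReduction π) {Jh : Submodule 𝕜⟦X⟧ (Eh ⊗[𝕜⟦X⟧] Eh)} {J : Submodule 𝕜 (E ⊗[𝕜] E)}
    (hJ : IsSubspaceDeformation (TensorProduct.map π π) Jh J)
    (hsat : ∀ k, 2 ≤ k → IsSaturated (sumSub k Jh)) : IsFlatDeformation π Jh J where
  free := inferInstance
  finite := inferInstance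
  surjective := hπ.surjective
  eq_zero_iff := hπ.eq_zero_iff
  deforms := hJ
  flat k := by
    refine quadComponent_free Jh k ?_
    rcases lt_or_ge k 2 with hk | hk
    · have := tensorPower_free (A := 𝕜⟦X⟧) (V := Eh) k
      rw [sumSub_eq_bot hk]
      exact isSaturated_bot
    · exact hsat k hk

/-- The algebra generated by `S_h` is isomorphic to `A_2(S_h)`. -/
theorem isSaturated_adjoin_singleton {Sh : Module.End 𝕜⟦X⟧ (Eh ⊗[𝕜⟦X⟧] Eh)}
    (h : IsSaturated (M := Module.End 𝕜⟦X⟧ (⨂[𝕜⟦X⟧]^2 Eh))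
      (Subalgebra.toSubmodule (genAlg 2 Sh))) :
    IsSaturated (Subalgebra.toSubmodule (Algebra.adjoin 𝕜⟦X⟧ {Sh})) := by
  refine IsSaturated.of_map (M' := Module.End 𝕜⟦X⟧ (⨂[𝕜⟦X⟧]^2 Eh))
    (f := (opAtHom (a := 0) (b := 0) (k := 2) rfl).toLinearMap) opAtHom_injective ?_
  rw [genAlg_two] at h
  exact h

theorem isSemisimpleRing_of_map {R B B' : Type*} [CommRing R] [Ring B] [Algebra R B] [Ring B']
    [Algebra R B'] {f : B →ₐ[R] B'} (hf : Function.Injective f) {C : Subalgebra R B}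
    (h : IsSemisimpleRing (C.map f)) : IsSemisimpleRing C :=
  (C.equivMapOfInjective f hf).symm.toRingEquiv.isSemisimpleRing

theorem isSemisimpleRing_adjoin_singleton {S : Module.End 𝕜 (E ⊗[𝕜] E)}
    (h : IsSemisimpleRing (genAlg 2 S)) : IsSemisimpleRing (Algebra.adjoin 𝕜 {S}) := by
  rw [genAlg_two] at h
  exact isSemisimpleRing_of_map (B' := Module.End 𝕜 (⨂[𝕜]^2 E)) opAtHom_injective h

theorem homTensorHomMap_injective (R M : Type*) [CommRing R] [AddCommGroup M] [Module R M]
    [Module.Free R M] [Module.Finite R M] :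
    Function.Injective (TensorProduct.homTensorHomMap (.id R) M M M M) := by
  have h := (homTensorHomEquiv R M M M M).injective
  rwa [← LinearEquiv.coe_toLinearMap, homTensorHomEquiv_toLinearMap] at h

theorem IsReduction.homTensorHomMap_map_endMap [Module.Free 𝕜⟦X⟧ Eh] [Module.Finite 𝕜⟦X⟧ Eh]
    (hπ : IsReduction π) (t : Module.End 𝕜⟦X⟧ Eh ⊗[𝕜⟦X⟧] Module.End 𝕜⟦X⟧ Eh) :
    TensorProduct.homTensorHomMap (.id 𝕜) E E E E (TensorProduct.map hπ.endMap hπ.endMap t) =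
      (hπ.tensorProduct hπ).endMap (TensorProduct.homTensorHomMap (.id 𝕜⟦X⟧) Eh Eh Eh Eh t) := by
  induction t with
  | zero => simp
  | add x y hx hy => simp only [map_add, hx, hy]
  | tmul φ ψ =>
    refine ((hπ.tensorProduct hπ).endMap_eq fun x => ?_).symm
    rw [TensorProduct.map_tmul, TensorProduct.homTensorHomMap_apply,
      TensorProduct.homTensorHomMap_apply]
    induction x with
    | zero => simp
    | add x y hx hy => simp only [map_add, hx, hy]
    | tmul v w =>
      simp only [TensorProduct.map_tmul]
      rw [hπ.isOperatorDeformation_endMap, hπ.isOperatorDeformation_endMap]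

/-- The relations of the quantum semigroup are a deformation: on both sides they are the commutators
with the operator. -/
theorem IsReduction.map_semigroupRel [Module.Free 𝕜⟦X⟧ Eh] [Module.Finite 𝕜⟦X⟧ Eh]
    [FiniteDimensional 𝕜 E] (hπ : IsReduction π) {Sh : Module.End 𝕜⟦X⟧ (Eh ⊗[𝕜⟦X⟧] Eh)}
    {S : Module.End 𝕜 (E ⊗[𝕜] E)} (hS : IsOperatorDeformation (TensorProduct.map π π) Sh S)
    {Jh : Submodule 𝕜⟦X⟧ (Module.End 𝕜⟦X⟧ Eh ⊗[𝕜⟦X⟧] Module.End 𝕜⟦X⟧ Eh)}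
    {J : Submodule 𝕜 (Module.End 𝕜 E ⊗[𝕜] Module.End 𝕜 E)}
    (hJh : Jh.map (TensorProduct.homTensorHomMap (.id 𝕜⟦X⟧) Eh Eh Eh Eh) =
      LinearMap.range (commutatorMap Sh))
    (hJ : J.map (TensorProduct.homTensorHomMap (.id 𝕜) E E E E) =
      LinearMap.range (commutatorMap S)) :
    Jh.map (TensorProduct.map hπ.endMap hπ.endMap) = J := by
  have hinj : Function.Injective (TensorProduct.homTensorHomMap (.id 𝕜) E E E E) :=
    homTensorHomMap_injective 𝕜 E
  have h2 := hπ.tensorProduct hπ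
  have hcomm : ∀ x, h2.endMap (commutatorMap Sh x) = commutatorMap S (h2.endMap x) := fun x => by
    rw [commutatorMap_apply, commutatorMap_apply, map_sub, h2.endMap_mul, h2.endMap_mul,
      h2.endMap_eq hS]
  have himg : (LinearMap.range (commutatorMap Sh)).map h2.endMap =
      LinearMap.range (commutatorMap S) :=
    map_range_of_isOperatorDeformation h2.endMap_isReduction.surjective hcomm
  refine Submodule.map_injective_of_injective hinj ?_
  rw [hJ, ← himg, ← hJh]
  ext y
  constructor
  · rintro ⟨_, ⟨t, ht, rfl⟩, rfl⟩
    exact ⟨_, ⟨t, ht, rfl⟩, (hπ.homTensorHomMap_map_endMap t).symm⟩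
  · rintro ⟨_, ⟨t, ht, rfl⟩, rfl⟩
    exact ⟨_, ⟨t, ht, rfl⟩, hπ.homTensorHomMap_map_endMap t⟩

end QuadraticDeformations

/-! ### Setting the parameter to zero -/

section EvalZero

variable (𝕜 : Type*) [Field 𝕜] (V : Type*) [AddCommGroup V] [Module 𝕜 V] [FiniteDimensional 𝕜 V]

instance : Module.Free 𝕜⟦X⟧ (Formal 𝕜 V) :=
  inferInstanceAs (Module.Free 𝕜⟦X⟧ (𝕜⟦X⟧ ⊗[𝕜] V))

instance : Module.Finite 𝕜⟦X⟧ (Formal 𝕜 V) :=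
  inferInstanceAs (Module.Finite 𝕜⟦X⟧ (𝕜⟦X⟧ ⊗[𝕜] V))

theorem isReduction_evalZero : IsReduction (evalZero 𝕜 V) := by
  let b := Module.finBasis 𝕜 V
  let bh : Basis (Fin (Module.finrank 𝕜 V)) 𝕜⟦X⟧ (Formal 𝕜 V) :=
    (Algebra.TensorProduct.basis 𝕜⟦X⟧ b : Basis _ 𝕜⟦X⟧ (𝕜⟦X⟧ ⊗[𝕜] V))
  refine isReduction_of_basis bh b fun i => ?_
  have h : bh i = Formal.mk 1 (b i) := Algebra.TensorProduct.basis_apply b i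
  rw [h, evalZero_mk, map_one, one_smul]

theorem evalZeroEnd_eq : evalZeroEnd 𝕜 V = (isReduction_evalZero 𝕜 V).endMap := by
  refine LinearMap.ext fun φ => ((isReduction_evalZero 𝕜 V).endMap_eq fun x => ?_).symm
  refine (isReduction_evalZero 𝕜 V).apply_eq_of_eq φ (y := Formal.mk 1 (evalZero 𝕜 V x)) ?_
  rw [evalZero_mk, map_one, one_smul]

end EvalZero

/-! ### Uniqueness of the eigenvalues and eigenspaces -/

section Uniqueness

variable {R : Type*} [CommRing R] {M : Type*} [AddCommGroup M] [Module R M]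

/-- The `j`-th projections of an eigenvector for `μ` vanish for `j ≠ i`, if `ev j - μ` is a unit. -/
theorem IsSpectralDecomposition.eq_of_hasEigenvalue [Module.IsTorsionFree R M] [IsDomain R] {n : ℕ}
    {S : Module.End R M} {ev : Fin n → R} {p : Fin n → Module.End R M}
    (h : IsSpectralDecomposition S ev p) {i : Fin n} {μ : R}
    (hμ : ∀ j, j ≠ i → IsUnit (ev j - μ)) (hS : S.HasEigenvalue μ) : μ = ev i := by
  obtain ⟨v, hv⟩ := hS.exists_hasEigenvector
  have h1 := h.smul_apply_eq i hv.apply_eq_smul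
  rw [h.apply_eq_self hμ hv.apply_eq_smul] at h1
  exact (sub_eq_zero.mp ((smul_eq_zero.mp h1).resolve_right hv.2)).symm

variable {𝕜 : Type*} [Field 𝕜]
  {E : Type*} [AddCommGroup E] [Module 𝕜 E] {Eh : Type*} [AddCommGroup Eh] [Module 𝕜⟦X⟧ Eh]
  {π : Eh →ₛₗ[(constantCoeff : 𝕜⟦X⟧ →+* 𝕜)] E}

/-- A submodule of a saturated submodule with the same reduction coincides with it. -/
theorem IsReduction.eq_of_le_of_map_eq [Module.Finite 𝕜⟦X⟧ Eh] (hπ : IsReduction π)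
    {P N : Submodule 𝕜⟦X⟧ Eh} (hle : P ≤ N) (hN : IsSaturated N) (h : P.map π = N.map π) :
    P = N := by
  refine le_antisymm hle (le_of_forall_eq_add_X_smul fun x hx => ?_)
  obtain ⟨y, hy, hyx⟩ : π x ∈ P.map π := h ▸ Submodule.mem_map_of_mem hx
  obtain ⟨z, hz⟩ := hπ.exists_sub_eq hyx.symm
  refine ⟨y, hy, z, hN _ z PowerSeries.X_ne_zero ?_, ?_⟩
  · rw [← hz]
    exact sub_mem hx (hle hy)
  · rw [← hz, add_sub_cancel]

theorem isUnit_sub_of_constantCoeff_ne {f g : 𝕜⟦X⟧} (h : constantCoeff f ≠ constantCoeff g) :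
    IsUnit (f - g) := by
  rw [PowerSeries.isUnit_iff_constantCoeff, map_sub]
  exact (sub_ne_zero.mpr h).isUnit

end Uniqueness

end QuadDef

theorem proposition2p5 {𝕜 : Type*} [RCLike 𝕜] {V : Type*} [AddCommGroup V] [Module 𝕜 V]
    [FiniteDimensional 𝕜 V]
    (S : Module.End 𝕜 (V ⊗[𝕜] V))
    (Sh : Module.End 𝕜⟦X⟧ (QuadDef.Formal 𝕜 V ⊗[𝕜⟦X⟧] QuadDef.Formal 𝕜 V))
    (hSh : QuadDef.IsOperatorDeformation
      (TensorProduct.map (QuadDef.evalZero 𝕜 V) (QuadDef.evalZero 𝕜 V)) Sh S)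
    (n : ℕ) (ev : Fin n → 𝕜) (hev_inj : Function.Injective ev)
    (hev : ∀ μ : 𝕜, S.HasEigenvalue μ ↔ ∃ i, ev i = μ)
    (hsplits : S.charpoly.Splits)
    (hsemisimple : ∀ k : ℕ, 2 ≤ k → IsSemisimpleRing (QuadDef.genAlg k S))
    (hsplitting : ∀ k : ℕ, 2 ≤ k →
      QuadDef.IsSplitting (Subalgebra.toSubmodule (QuadDef.genAlg k Sh))) :
    ∃ (evh : Fin n → 𝕜⟦X⟧)
      (Ih : Fin n → Submodule 𝕜⟦X⟧ (QuadDef.Formal 𝕜 V ⊗[𝕜⟦X⟧] QuadDef.Formal 𝕜 V)),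
      -- the eigenvalues and the eigenspaces deform, and the latter still decompose the square
      (∀ i, PowerSeries.constantCoeff (evh i) = ev i) ∧
      (∀ i, Ih i = Sh.eigenspace (evh i)) ∧
      (∀ i, QuadDef.IsSubspaceDeformation
        (TensorProduct.map (QuadDef.evalZero 𝕜 V) (QuadDef.evalZero 𝕜 V))
        (Ih i) (S.eigenspace (ev i))) ∧
      DirectSum.IsInternal Ih ∧
      -- the deformations of the eigenvalues are unique
      (∀ i (μ : 𝕜⟦X⟧), PowerSeries.constantCoeff μ = ev i → Sh.HasEigenvalue μ → μ = evh i) ∧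
      -- the deformations of the eigenspaces are unique
      (∀ i (μ : 𝕜⟦X⟧) (P : Submodule 𝕜⟦X⟧ (QuadDef.Formal 𝕜 V ⊗[𝕜⟦X⟧] QuadDef.Formal 𝕜 V)),
        PowerSeries.constantCoeff μ = ev i → P ≤ Sh.eigenspace μ →
        QuadDef.IsSubspaceDeformation
          (TensorProduct.map (QuadDef.evalZero 𝕜 V) (QuadDef.evalZero 𝕜 V))
          P (S.eigenspace (ev i)) → P = Ih i) ∧
      -- a)
      (∀ m, QuadDef.IsWellSituated (Ih m) (⨆ (i) (_ : i ≠ m), Ih i)) ∧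
      -- b)
      (∀ m, QuadDef.IsFlatDeformation (QuadDef.evalZero 𝕜 V)
        (⨆ (i) (_ : i ≠ m), Ih i) (⨆ (i) (_ : i ≠ m), S.eigenspace (ev i))) ∧
      -- c)
      QuadDef.IsFlatDeformation (QuadDef.evalZeroEnd 𝕜 V)
        (QuadDef.semigroupRel Ih) (QuadDef.semigroupRel fun i => S.eigenspace (ev i)) := by
  open QuadDef PowerSeries in
  have hπ := isReduction_evalZero 𝕜 V
  have hπ2 := hπ.tensorProduct hπ
  have hsat : ∀ k, 2 ≤ k → IsSaturated (M := Module.End 𝕜⟦X⟧ (⨂[𝕜⟦X⟧]^k (Formal 𝕜 V)))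
      (Subalgebra.toSubmodule (genAlg k Sh)) := fun k hk => by
    have := tensorPower_free (A := 𝕜⟦X⟧) (V := Formal 𝕜 V) k
    have := tensorPower_finite (A := 𝕜⟦X⟧) (V := Formal 𝕜 V) k
    exact (hsplitting k hk).isSaturated
  have := isSemisimpleRing_adjoin_singleton (hsemisimple 2 le_rfl)
  obtain ⟨p, hp⟩ := exists_spectralDecomposition hev_inj (aeval_nodal_eq_zero hev hsplits)
  have hunit : ∀ i j, i ≠ j → IsUnit (ev i - ev j) := fun i j hij =>
    (sub_ne_zero.mpr (hev_inj.ne hij)).isUnit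
  have hne : ∀ i, S.eigenspace (ev i) ≠ ⊥ := fun i => (hev (ev i)).mpr ⟨i, rfl⟩
  obtain ⟨evh, e, he, hevh, hd⟩ := exists_spectralDecomposition_lift hπ2 hSh
    (isSaturated_adjoin_singleton (hsat 2 le_rfl)) hp fun i h0 =>
      hne i (by rw [hp.eigenspace_eq hunit, h0, LinearMap.range_zero])
  have hunith : ∀ i j (μ : 𝕜⟦X⟧), constantCoeff μ = ev i → j ≠ i → IsUnit (evh j - μ) :=
    fun i j μ hμ hij => isUnit_sub_of_constantCoeff_ne (by
      rw [hevh, hμ]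
      exact hev_inj.ne hij)
  have hunit2 : ∀ i j, i ≠ j → IsUnit (evh i - evh j) := fun i j hij =>
    hunith j i _ (hevh j) hij
  have heig : (fun i => S.eigenspace (ev i)) = fun i => LinearMap.range (p i) :=
    funext (hp.eigenspace_eq hunit)
  have hmap : ∀ i, (LinearMap.range (e i)).map (TensorProduct.map (evalZero 𝕜 V) (evalZero 𝕜 V)) =
      S.eigenspace (ev i) := fun i => by
    rw [hp.eigenspace_eq hunit]
    exact map_range_of_isOperatorDeformation hπ2.surjective (hd i)
  have huniq : ∀ i (μ : 𝕜⟦X⟧), constantCoeff μ = ev i → Sh.HasEigenvalue μ → μ = evh i :=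
    fun i μ hμ h => he.eq_of_hasEigenvalue (fun j hj => hunith i j μ hμ hj) h
  have hcompl : ∀ m, IsWellSituated (LinearMap.range (e m))
      (⨆ (i) (_ : i ≠ m), LinearMap.range (e i)) := fun m k hk =>
    hπ.isCompl_interSub_sumSub hSh he hunit2 (hsemisimple k hk) (hsat k hk) m
  refine ⟨evh, fun i => LinearMap.range (e i), hevh, fun i => (he.eigenspace_eq hunit2 i).symm,
    fun i => ⟨⟨_, he.isCompl_range i⟩, hmap i⟩, he.isInternal, huniq, fun i μ P hμ hP hdef => ?_,
    hcompl, fun m => ?_, ?_⟩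
  · -- the reduction of `P` is not zero, so that `μ` is an eigenvalue
    have hP0 : Sh.HasEigenvalue μ := by
      intro h0
      have h1 : P = ⊥ := le_bot_iff.mp (hP.trans h0.le)
      refine hne i ?_
      rw [← hdef.map_eq, h1, Submodule.map_bot]
    rw [huniq i μ hμ hP0, he.eigenspace_eq hunit2] at hP
    exact hπ2.eq_of_le_of_map_eq hP (IsSplitting.isSaturated ⟨_, he.isCompl_range i⟩)
      (hdef.map_eq.trans (hmap i).symm)
  · refine hπ.isFlatDeformation ⟨⟨_, (he.isCompl_range m).symm⟩, ?_⟩ fun k hk => ?_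
    · simp only [Submodule.map_iSup, hmap]
    · have := tensorPower_free (A := 𝕜⟦X⟧) (V := Formal 𝕜 V) k
      exact IsSplitting.isSaturated ⟨_, (hcompl m k hk).symm⟩
  · have hrel := map_semigroupRel he hunit2
    rw [evalZeroEnd_eq]
    refine hπ.endMap_isReduction.isFlatDeformation ⟨IsSaturated.isSplitting ?_, ?_⟩ fun k hk =>
      hπ.isSaturated_sumSub hSh hrel (hsemisimple k hk) (hsat k hk)
    · refine IsSaturated.of_map (homTensorHomMap_injective 𝕜⟦X⟧ (Formal 𝕜 V)) ?_
      rw [hrel]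
      have := hπ2.isSaturated_commutators (fun _ : Unit => hSh) (by rwa [Set.range_const])
        (by rw [Set.range_const]; exact isSaturated_adjoin_singleton (hsat 2 le_rfl))
      rwa [iSup_const] at this
    · rw [heig]
      exact hπ.map_semigroupRel hSh hrel (map_semigroupRel hp hunit)
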